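/- Logarithms are to base $2$ and $0\log 0=0$. Let $\mathcal P_n=\{(p_1,\dots,p_n): p_1\ge\dots\ge p_n\ge 0,\ \sum_i p_i=1\}$. For $m\ge 1$ and $\mathbf p^{(1)},\dots,\mathbf p^{(m)}\in\mathcal P_n$, a joint distribution with these marginals is an array $M=[M_{i_1,\dots,i_m}]$ of non-negative reals, indexed by $\{1,\dots,n\}^m$, such that for all $j$ and $t$ the sum of the entries with $i_j=t$ is $p^{(j)}_t$; its entropy is $H(M)=-\sum M_{i_1,\dots,i_m}\log M_{i_1,\dots,i_m}$. Two distributions. For non-increasing $\mathbf p,\mathbf q$, padded with zeros to a common length $N$, the procedure $\mathrm{Couple}(\mathbf p,\mathbf q)$ computes an $N\times N$ matrix with row sums $\mathbf p$ and column sums $\mathbf q$ as follows. If $p_j<q_j$ at the largest $j$ with $p_j\ne q_j$, exchange $\mathbf p$ and $\mathbf q$ (and transpose the matrix at the end). Let $\mathbf z$ be given by $\sum_{k\le i}z_k=\min\{\sum_{k\le i}p_k,\sum_{k\le i}q_k\}$ and start from the diagonal matrix $\mathrm{diag}(\mathbf z)$. For $i=N,\dots,1$: if the entries $m_{k,i}$,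 $k\ge i$, of column $i$ sum to more than $x=q_i$, scan $k=i+1,i+2,\dots$ and select $k$ as long as the sum of the selected $m_{k,i}$ stays smaller than $x$, stopping at the first failure; with $s$ the sum of the selected entries, put $m_{i,i}\leftarrow x-s$, $m_{i,i-1}\leftarrow z_i-(x-s)$ and move every entry $m_{k,i}$ with $k>i$ that was not selected to position $(k,i-1)$; then do the same with rows in place of columns and $p_i$ in place of $q_i$. $m$ distributions. Let $\kappa=\lceil\log m\rceil$ and append $2^\kappa-m$ copies of $\mathbf p^{(1)}$. Put the $2^\kappa$ distributions at the leaves of a complete binary tree. From the leaves to the root, each inner node receives the non-zero entries of the matrix $\mathrm{Couple}(\mathbf x,\mathbf y)$, sorted in non-increasing order, where $\mathbf x,\mathbf y$ are the vectors at its two children; with each component one records its index vector, which is the concatenation of the index vectors of the two components coupled. The vector at the root and its index vectors are the sparse form of a $2^\kappa$-dimensional array; summing out the coordinates of the appended copies gives the output $M$, which is returned in sparse form, that is, as the list of its non-zero entries, each with its index vector. Theorem. There is a polynomial $T$ such that for all $m\ge 1$, $n$, and $\mathbf p^{(1)},\dots,\mathbf p^{(m)}\in\mathcal P_n$: a joint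 distribution with marginals $\mathbf p^{(1)},\dots,\mathbf p^{(m)}$ of minimum entropy exists; the output $M$ of the algorithm is a joint distribution with marginals $\mathbf p^{(1)},\dots,\mathbf p^{(m)}$; if $M^*$ has minimum entropy among all joint distributions with these marginals, then $$H(M)\le H(M^*)+\lceil\log m\rceil;$$ and the algorithm takes at most $T(mn)$ steps, where additions, subtractions and comparisons of real numbers, and reading or writing an array cell or handling a list cell, take unit time. -/

import Mathlib

namespace MinEntropyCoupling

/-! ## Distributions, couplings, entropy -/

/-- The set of ordered probability vectors with `n` components. -/
def orderedSimplex (n : ℕ) : Set (Fin n → ℝ) :=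
  {p | (∀ i, 0 ≤ p i) ∧ ∑ i, p i = 1 ∧ Antitone p}

/-- The array `M`, indexed by `m`-tuples, is a joint distribution whose marginals are
`p 0, …, p (m - 1)`. -/
def IsJoint {m n : ℕ} (p : Fin m → Fin n → ℝ) (M : (Fin m → Fin n) → ℝ) : Prop :=
  (∀ f, 0 ≤ M f) ∧
    ∀ (j : Fin m) (t : Fin n), ∑ f ∈ Finset.univ.filter (fun f => f j = t), M f = p j t

/-- Shannon entropy in bits, with the convention `0 log 0 = 0`. -/
noncomputable def entropy {ι : Type*} [Fintype ι] (x : ι → ℝ) : ℝ :=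
  -∑ i, x i * Real.logb 2 (x i)

/-- `M` has minimum entropy among all joint distributions with marginals `p`. -/
def IsMinEntropyJoint {m n : ℕ} (p : Fin m → Fin n → ℝ) (M : (Fin m → Fin n) → ℝ) : Prop :=
  IsJoint p M ∧ ∀ N, IsJoint p N → entropy M ≤ entropy N

/-! ## Step counting

Programs are written in a monad that carries the number of steps executed so far.  The model is
the unit-cost real RAM: an addition, a subtraction or a comparison of real numbers, the reading or
writing of an array cell, and the handling of one list cell cost one step each; every call of a
procedure and every iteration of a loop costs one further step, which pays for the constant number
of operations on loop counters and pairs.  Operations on whole lists or arrays are charged by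
their size. -/

/-- The result of a computation together with the number of steps it took. -/
structure Timed (α : Type) where
  val : α
  steps : ℕ

instance : Monad Timed where
  pure a := ⟨a, 0⟩
  bind x f := ⟨(f x.val).val, x.steps + (f x.val).steps⟩

/-- One step. -/
def tick : Timed Unit := ⟨(), 1⟩

/-- Addition of reals. -/
noncomputable def add (x y : ℝ) : Timed ℝ := ⟨x + y, 1⟩

/-- Subtraction of reals. -/
noncomputable def sub (x y : ℝ) : Timed ℝ := ⟨x - y, 1⟩

/-- Comparison of reals. -/
noncomputable def lt (x y : ℝ) : Timed Bool := ⟨decide (x < y), 1⟩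

/-- Test whether a real is nonzero. -/
noncomputable def nonzero (x : ℝ) : Timed Bool := ⟨decide (x ≠ 0), 1⟩

/-- A fresh array of zeros with `size` cells (cells beyond the end read as zero). -/
noncomputable def newArray {I : Type} (size : ℕ) : Timed (I → ℝ) := ⟨fun _ => 0, size + 1⟩

/-- Read a cell. -/
noncomputable def read {I : Type} (A : I → ℝ) (i : I) : Timed ℝ := ⟨A i, 1⟩

/-- Write a cell. -/
noncomputable def write {I : Type} [DecidableEq I] (A : I → ℝ) (i : I) (v : ℝ) : Timed (I → ℝ) :=
  ⟨Function.update A i v, 1⟩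

/-- Length of a list. -/
def len {α : Type} (L : List α) : Timed ℕ := ⟨L.length, L.length + 1⟩

/-- Concatenation of two lists. -/
def append {α : Type} (K L : List α) : Timed (List α) := ⟨K ++ L, K.length + L.length + 1⟩

/-- The list of `c` copies of `a`. -/
def copies {α : Type} (c : ℕ) (a : α) : Timed (List α) := ⟨List.replicate c a, c + 1⟩

/-- The first `c` entries of a list. -/
def prefixOf {α : Type} (c : ℕ) (L : List α) : Timed (List α) := ⟨L.take c, c + 1⟩

/-- Equality test for two index vectors. -/
def sameIndex (K L : List ℕ) : Timed Bool := ⟨decide (K = L), K.length + L.length + 1⟩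

/-- `for k = a, a + 1, …, a + c - 1 do s ← body k s`. -/
def forUp {σ : Type} (body : ℕ → σ → Timed σ) : ℕ → ℕ → σ → Timed σ
  | _, 0, s => do tick; pure s
  | a, c + 1, s => do
      tick
      let s₁ ← body a s
      forUp body (a + 1) c s₁

/-- `for k = c - 1, c - 2, …, 0 do s ← body k s`. -/
def forDown {σ : Type} (body : ℕ → σ → Timed σ) : ℕ → σ → Timed σ
  | 0, s => do tick; pure s
  | c + 1, s => do
      tick
      let s₁ ← body c s
      forDown body c s₁

/-! ## The algorithm for two distributions

Indices start at `0`.  Both distributions are arrays of the same length `N`, sorted in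
non-increasing order (shorter ones are padded by zeros). -/

/-- The greatest lower bound `z` of `p` and `q` in the majorization order, from
`z 0 + … + z i = min (p 0 + … + p i) (q 0 + … + q i)`.  The loop keeps the partial sums of
`p`, `q`, `z` and the array `z`. -/
noncomputable def glb (N : ℕ) (p q : ℕ → ℝ) : Timed (ℕ → ℝ) := do
  let z₀ ← newArray N
  let r ← forUp (σ := (ℝ × ℝ × ℝ) × (ℕ → ℝ)) (fun i s => do
    let pᵢ ← read p i
    let qᵢ ← read q i
    let sp ← add s.1.1 pᵢ
    let sq ← add s.1.2.1 qᵢ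
    let c ← lt sp sq
    let zᵢ ← sub (if c then sp else sq) s.1.2.2
    let sz ← add s.1.2.2 zᵢ
    let z ← write s.2 i zᵢ
    pure ((sp, sq, sz), z)) 0 N ((0, 0, 0), z₀)
  pure r.2

/-- The greedy scan of the cells `A k, A (k + 1), …, A (k + c - 1)`: cells are selected as long as
the sum of the selected ones stays below `x`.  Returns the first index that is not selected and
the sum of the selected cells. -/
noncomputable def scan (A : ℕ → ℝ) (x : ℝ) : ℕ → ℕ → ℝ → Timed (ℕ × ℝ)
  | k, 0, sum => do tick; pure (k, sum)
  | k, c + 1, sum => do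
      tick
      let a ← read A k
      let t ← add sum a
      let b ← lt t x
      if b then scan A x (k + 1) c t else pure (k, sum)

/-- Repair of line `i`, where the cells of line `l` are `pos 0 l, pos 1 l, …`, the desired
sum of the line is `x`, and `z` is the mass on the diagonal.  If the line carries more than `x`,
split `z` into `zd + zr` and select cells beyond the diagonal such that `zd` and the selected
cells sum to `x`; `zr` and the other cells beyond the diagonal are moved to line `i - 1`. -/
noncomputable def repair (N : ℕ) (pos : ℕ → ℕ → ℕ × ℕ) (i : ℕ) (z x : ℝ) (M : ℕ × ℕ → ℝ) :
    Timed (ℕ × ℕ → ℝ) := do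
  tick
  let total ← forUp (fun k s => do
    let a ← read M (pos k i)
    add s a) i (N - i) 0
  let b ← lt x total
  if b then
    let r ← scan (fun k => M (pos k i)) x (i + 1) (N - (i + 1)) 0
    let zd ← sub x r.2
    let zr ← sub z zd
    let M₁ ← write M (pos i i) zd
    let M₂ ← write M₁ (pos i (i - 1)) zr
    forUp (fun k M' => do
      let a ← read M' (pos k i)
      let M'' ← write M' (pos k (i - 1)) a
      write M'' (pos k i) 0) r.1 (N - r.1) M₂
  else pure M

/-- The coupling of `p` and `q`: start from the diagonal matrix `z`, and for
`i = N - 1, …, 0` repair column `i` and then row `i`. -/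
noncomputable def couplingCore (N : ℕ) (p q : ℕ → ℝ) : Timed (ℕ × ℕ → ℝ) := do
  let M₀ ← newArray (N * N)
  let z ← glb N p q
  let M₁ ← forUp (fun i M => do
    let zᵢ ← read z i
    write M (i, i) zᵢ) 0 N M₀
  forDown (fun i M => do
    let zᵢ ← read z i
    let qᵢ ← read q i
    let M' ← repair N (fun k l => (k, l)) i zᵢ qᵢ M
    let pᵢ ← read p i
    repair N (fun k l => (l, k)) i zᵢ pᵢ M') N M₁

/-- Whether `p j < q j` at the largest index `j < c` with `p j ≠ q j`. -/
noncomputable def mustSwap (p q : ℕ → ℝ) : ℕ → Timed Bool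
  | 0 => do tick; pure false
  | c + 1 => do
      tick
      let a ← read p c
      let b ← read q c
      let l ← lt a b
      let g ← lt b a
      if l then pure true else if g then pure false else mustSwap p q c

/-- The coupling algorithm for two distributions; the matrix has row sums `p` and column sums `q`.
If the two distributions are exchanged at the beginning, the result is transposed back. -/
noncomputable def minEntropyCoupling (N : ℕ) (p q : ℕ → ℝ) : Timed (ℕ × ℕ → ℝ) := do
  let swap ← mustSwap p q N
  if swap then
    let M ← couplingCore N q p
    let R₀ ← newArray (N * N)
    forUp (fun s R => forUp (fun t R' => do
      let a ← read M (t, s)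
      write R' (s, t) a) 0 N R) 0 N R₀
  else couplingCore N p q

/-! ## The algorithm for `m` distributions -/

/-- A component of a joint distribution together with its index vector.  A list of entries is the
sparse form of an array. -/
abbrev Entry : Type := ℝ × List ℕ

/-- Insert an entry into a list sorted by non-increasing value. -/
noncomputable def insertEntry (e : Entry) : List Entry → Timed (List Entry)
  | [] => do tick; pure [e]
  | f :: L => do
      tick
      let b ← lt f.1 e.1
      if b then pure (e :: f :: L)
      else do
        let L' ← insertEntry e L
        pure (f :: L')

/-- Sort entries by non-increasing value. -/
noncomputable def sortEntries : List Entry → Timed (List Entry)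
  | [] => do tick; pure []
  | e :: L => do
      tick
      let L' ← sortEntries L
      insertEntry e L'

/-- The entries `(x, ⟨k⟩), (y, ⟨k + 1⟩), …` of a single distribution `x, y, …`. -/
noncomputable def number : ℕ → List ℝ → Timed (List Entry)
  | _, [] => do tick; pure []
  | k, x :: L => do
      tick
      let L' ← number (k + 1) L
      pure ((x, [k]) :: L')

/-- Copy the values of a list of entries into an array, from cell `k` on. -/
noncomputable def load : ℕ → List Entry → (ℕ → ℝ) → Timed (ℕ → ℝ)
  | _, [], A => do tick; pure A
  | k, e :: L, A => do
      tick
      let A' ← write A k e.1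
      load (k + 1) L A'

/-- The nonzero components of `M` in row `s`, from column `t` on, with the concatenated
index vectors. -/
noncomputable def collectRow (M : ℕ × ℕ → ℝ) (s : ℕ) (e : Entry) :
    ℕ → List Entry → Timed (List Entry)
  | _, [] => do tick; pure []
  | t, f :: F => do
      tick
      let v ← read M (s, t)
      let L ← collectRow M s e (t + 1) F
      let b ← nonzero v
      if b then do
        let ind ← append e.2 f.2
        pure ((v, ind) :: L)
      else pure L

/-- The nonzero components of `M`, from row `s` on, with the concatenated index vectors. -/
noncomputable def collect (M : ℕ × ℕ → ℝ) (F : List Entry) :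
    ℕ → List Entry → Timed (List Entry)
  | _, [] => do tick; pure []
  | s, e :: E => do
      tick
      let R ← collectRow M s e 0 F
      let L ← collect M F (s + 1) E
      append R L

/-- An inner node of the tree: couple the distributions of the two children, and return the
nonzero components of the coupling in non-increasing order, with their index vectors. -/
noncomputable def combine (E F : List Entry) : Timed (List Entry) := do
  let a ← len E
  let b ← len F
  let N := max a b
  let A ← newArray N
  let B ← newArray N
  let p ← load 0 E A
  let q ← load 0 F B
  let M ← minEntropyCoupling N p q
  let L ← collect M F 0 E
  sortEntries L

/-- One level of the tree: neighbouring nodes are combined in pairs. -/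
noncomputable def combinePairs : List (List Entry) → Timed (List (List Entry))
  | E :: F :: rest => do
      tick
      let G ← combine E F
      let rest' ← combinePairs rest
      pure (G :: rest')
  | nodes => do tick; pure nodes

/-- The leaves: every input distribution, numbered and sorted. -/
noncomputable def leaves : List (List ℝ) → Timed (List (List Entry))
  | [] => do tick; pure []
  | x :: P => do
      tick
      let E ← number 0 x
      let E' ← sortEntries E
      let rest ← leaves P
      pure (E' :: rest)

/-- The least `κ` with `m ≤ 2 ^ κ`, together with `2 ^ κ`, by repeated doubling. -/
def depth (m : ℕ) : Timed (ℕ × ℕ) :=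
  forUp (fun _ s => pure (if s.2 < m then (s.1 + 1, 2 * s.2) else s)) 0 m (0, 1)

/-- Add the value `v` to the cell `ind` of an array in sparse form. -/
noncomputable def accumulate (v : ℝ) (ind : List ℕ) : List Entry → Timed (List Entry)
  | [] => do tick; pure [(v, ind)]
  | f :: L => do
      tick
      let b ← sameIndex ind f.2
      if b then do
        let w ← add f.1 v
        pure ((w, f.2) :: L)
      else do
        let L' ← accumulate v ind L
        pure (f :: L')

/-- The marginal on the first `m` coordinates of a joint distribution in sparse form. -/
noncomputable def project (m : ℕ) : List Entry → Timed (List Entry)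
  | [] => do tick; pure []
  | e :: L => do
      tick
      let L' ← project m L
      let b ← nonzero e.1
      if b then do
        let ind ← prefixOf m e.2
        accumulate e.1 ind L'
      else pure L'

/-- The algorithm for any number of distributions.  The number of leaves is raised to the next
power of two by further copies of the first distribution; the tree is evaluated level by level;
the joint distribution found at the root is returned in sparse form, after the coordinates of the
added copies have been summed out. -/
noncomputable def minEntropyJoint (P : List (List ℝ)) : Timed (List Entry) := do
  let m ← len P
  let d ← depth m
  let E ← leaves P
  let C ← copies (d.2 - m) (E.headD [])
  let nodes ← append E C
  let top ← forUp (fun _ nodes => combinePairs nodes) 0 d.1 nodes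
  project m (top.headD [])

/-- The algorithm run on `p 0, …, p (m - 1)`. -/
noncomputable def run {m n : ℕ} (p : Fin m → Fin n → ℝ) : Timed (List Entry) :=
  minEntropyJoint (List.ofFn fun i => List.ofFn (p i))

/-- `L` is the sparse form of the array `M`: it lists exactly the nonzero components of `M`,
each once, with their index vectors. -/
def IsSparseForm {m n : ℕ} (L : List Entry) (M : (Fin m → Fin n) → ℝ) : Prop :=
  (L.map Prod.snd).Nodup ∧
    ∀ (v : ℝ) (ind : List ℕ), (v, ind) ∈ L ↔
      v ≠ 0 ∧ ∃ f : Fin m → Fin n, ind = List.ofFn (fun i => (f i : ℕ)) ∧ v = M f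

end MinEntropyCoupling

/-!
Why the coupling algorithm is within `⌈log m⌉` bits of the optimum.

*Two distributions.* Let `A i`, `B i` be the sums of the first `i` components of `p` and `q`, and
let `z` be their greatest lower bound (`meet`), whose first `i` components sum to
`min (A i) (B i)`.  The hook `h` is the set of cells `(k, l)` with `max k l = h`; at the start its
only nonzero cell is the diagonal one, of value `z h`.  Just before line `i` is repaired, column `i`
exceeds `q i` by the positive part of `B i - A i` and row `i` exceeds `p i` by the positive part of
`A i - B i` (`Stage.col_sum`).  So at most one of the two is repaired, and line `0` never is.  The
split of the diagonal entry is possible because the first cell that the greedy scan rejects is at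
most a later component of `z`, and `z` is non-increasing.  A column repair changes neither the row
sums nor the mass of a hook, and leaves at most two nonzero cells on each hook (`Stage.moved`).
None of this depends on which of the two distributions comes first, so the initial exchange does
not matter for correctness.

*The tree.* Since every component of `z` is split into at most two parts, the `2 k` largest entries
of the coupling weigh at least as much as the first `k` components of `z`, that is, at least as much
as the `k` largest components of `p` or those of `q`.  By induction, for a node with `d` leaves
below it, the `d * k` largest components weigh at least as much as the `k` largest components of the
distribution at some leaf (`Node.major`, proved in `Node.combine`).

*Entropy.* The `k` largest components of a joint distribution `N` agree with at most `k` values of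
any coordinate, so they weigh at most as much as the `k` largest components of any marginal
(`sum_le_sum_take_of_isJoint`).  Hence, with `d = 2 ^ ⌈log m⌉`, the `d * k` largest components at the
root weigh at least as much as the `k` largest components of `N`.  Gibbs' inequality against the
vector that splits every component of `N` into `d` equal parts, and summation by parts, bound the
entropy at the root by `H(N) + log d` (`sum_mul_log_ge`).  Summing out the added coordinates merges
components, which does not increase the entropy (`sum_mul_log_le_of_merge`).

*The rest.* A minimum exists by compactness (`exists_isMinEntropyJoint`).  A node with `d` leaves
below it has at most `d * n` components, so that all lists have size at most `2 m n`, and the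
running time is polynomial (`exists_root`).
-/

namespace MinEntropyCoupling

/-! ### Running timed programs -/

section Timed

variable {α β σ : Type}

@[simp] theorem bind_val (x : Timed α) (f : α → Timed β) : (x >>= f).val = (f x.val).val := rfl

@[simp] theorem bind_steps (x : Timed α) (f : α → Timed β) :
    (x >>= f).steps = x.steps + (f x.val).steps := rfl

@[simp] theorem pure_val (a : α) : (pure a : Timed α).val = a := rfl

@[simp] theorem pure_steps (a : α) : (pure a : Timed α).steps = 0 := rfl

theorem forUp_inv (I : ℕ → σ → Prop) (body : ℕ → σ → Timed σ) (a c : ℕ) (s : σ)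
    (h : ∀ k s, a ≤ k → k < a + c → I k s → I (k + 1) (body k s).val) (h₀ : I a s) :
    I (a + c) (forUp body a c s).val := by
  induction c generalizing a s with
  | zero => exact h₀
  | succ c ih =>
    have := ih (a + 1) (body a s).val (fun k s h₁ h₂ => h k s (by omega) (by omega))
      (h a s le_rfl (by omega) h₀)
    rw [show a + (c + 1) = a + 1 + c by omega]
    exact this

theorem forDown_inv (I : ℕ → σ → Prop) (body : ℕ → σ → Timed σ) (c : ℕ) (s : σ)
    (h : ∀ k s, k < c → I (k + 1) s → I k (body k s).val) (h₀ : I c s) :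
    I 0 (forDown body c s).val := by
  induction c generalizing s with
  | zero => exact h₀
  | succ c ih =>
    exact ih (body c s).val (fun k s h₁ => h k s (by omega)) (h c s (by omega) h₀)

/-- The number of steps of a loop, when the body is cheap on the states that satisfy a loop
invariant. -/
theorem forUp_steps_le_of_inv (I : ℕ → σ → Prop) (body : ℕ → σ → Timed σ) (B a c : ℕ) (s : σ)
    (h : ∀ k s, a ≤ k → k < a + c → I k s → I (k + 1) (body k s).val)
    (hB : ∀ k s, a ≤ k → k < a + c → I k s → (body k s).steps ≤ B) (h₀ : I a s) :
    (forUp body a c s).steps ≤ c * (B + 1) + 1 := by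
  induction c generalizing a s with
  | zero => simp [forUp, tick]
  | succ c ih =>
    have h₁ := ih (a + 1) (body a s).val (fun k s h₁ h₂ => h k s (by omega) (by omega))
      (fun k s h₁ h₂ => hB k s (by omega) (by omega)) (h a s le_rfl (by omega) h₀)
    have h₂ := hB a s le_rfl (by omega) h₀
    simp only [forUp, tick, bind_steps]
    rw [add_mul]
    omega

theorem forUp_steps_le (body : ℕ → σ → Timed σ) (B a c : ℕ) (s : σ)
    (hB : ∀ k s, (body k s).steps ≤ B) : (forUp body a c s).steps ≤ c * (B + 1) + 1 :=
  forUp_steps_le_of_inv (fun _ _ => True) body B a c s (fun _ _ _ _ _ => trivial)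
    (fun k s _ _ _ => hB k s) trivial

theorem forDown_steps_le (body : ℕ → σ → Timed σ) (B c : ℕ) (s : σ)
    (hB : ∀ k s, (body k s).steps ≤ B) : (forDown body c s).steps ≤ c * (B + 1) + 1 := by
  induction c generalizing s with
  | zero => simp [forDown, tick]
  | succ c ih =>
    have h₁ := ih (body c s).val
    have h₂ := hB c s
    simp only [forDown, tick, bind_steps]
    rw [add_mul]
    omega

end Timed

/-! ### The greatest lower bound of two distributions -/

/-- The component `i` of the greatest lower bound of `p` and `q` in the majorization order. -/
noncomputable def meet (p q : ℕ → ℝ) (i : ℕ) : ℝ :=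
  min (∑ k ∈ Finset.range (i + 1), p k) (∑ k ∈ Finset.range (i + 1), q k) -
    min (∑ k ∈ Finset.range i, p k) (∑ k ∈ Finset.range i, q k)

theorem meet_comm (p q : ℕ → ℝ) : meet p q = meet q p := by
  funext i
  simp only [meet]
  rw [min_comm, min_comm (∑ k ∈ Finset.range i, p k)]

theorem sum_meet (p q : ℕ → ℝ) (c : ℕ) :
    ∑ i ∈ Finset.range c, meet p q i =
      min (∑ k ∈ Finset.range c, p k) (∑ k ∈ Finset.range c, q k) := by
  simp only [meet]
  rw [Finset.sum_range_sub
    (fun i => min (∑ k ∈ Finset.range i, p k) (∑ k ∈ Finset.range i, q k))]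
  simp

theorem meet_nonneg {p q : ℕ → ℝ} (hp : ∀ k, 0 ≤ p k) (hq : ∀ k, 0 ≤ q k) (i : ℕ) :
    0 ≤ meet p q i := by
  simp only [meet, Finset.sum_range_succ, sub_nonneg]
  exact min_le_min (by linarith [hp i]) (by linarith [hq i])

/-- A minimum of two concave sequences is concave. -/
theorem antitone_meet {p q : ℕ → ℝ} (hp : Antitone p) (hq : Antitone q) :
    Antitone (meet p q) := by
  refine antitone_nat_of_succ_le fun i => ?_
  have h₁ := hp (Nat.le_succ i)
  have h₂ := hq (Nat.le_succ i)
  simp only [meet, Finset.sum_range_succ, Nat.succ_eq_add_one] at *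
  set a := ∑ k ∈ Finset.range i, p k
  set b := ∑ k ∈ Finset.range i, q k
  rcases le_total (a + p i) (b + q i) with h | h
  · rw [min_eq_left h]
    linarith [min_le_left (a + p i + p (i + 1)) (b + q i + q (i + 1)), min_le_left a b]
  · rw [min_eq_right h]
    linarith [min_le_right (a + p i + p (i + 1)) (b + q i + q (i + 1)), min_le_right a b]

theorem glb_val (N : ℕ) (p q : ℕ → ℝ) :
    (glb N p q).val = fun i => if i < N then meet p q i else 0 := by
  have := forUp_inv (σ := (ℝ × ℝ × ℝ) × (ℕ → ℝ)) (fun c s => s =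
      ((∑ k ∈ Finset.range c, p k, ∑ k ∈ Finset.range c, q k,
        min (∑ k ∈ Finset.range c, p k) (∑ k ∈ Finset.range c, q k)),
        fun i => if i < c then meet p q i else 0))
    (fun i s => do
      let pᵢ ← read p i
      let qᵢ ← read q i
      let sp ← add s.1.1 pᵢ
      let sq ← add s.1.2.1 qᵢ
      let c ← lt sp sq
      let zᵢ ← sub (if c then sp else sq) s.1.2.2
      let sz ← add s.1.2.2 zᵢ
      let z ← write s.2 i zᵢ
      pure ((sp, sq, sz), z)) 0 N ((0, 0, 0), fun _ => 0) ?_ (by simp)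
  · rw [zero_add] at this
    exact congrArg Prod.snd this
  · rintro k s - - rfl
    have hmin : ∀ a b : ℝ, (if a < b then a else b) = min a b := fun a b => by
      split_ifs with h
      · exact (min_eq_left h.le).symm
      · exact (min_eq_right (not_lt.1 h)).symm
    simp only [bind_val, pure_val, read, add, sub, lt, write, decide_eq_true_eq, hmin,
      ← Finset.sum_range_succ, add_sub_cancel, Prod.mk.injEq, true_and]
    funext i
    rcases lt_trichotomy i k with h | rfl | h
    · rw [Function.update_of_ne h.ne, if_pos h, if_pos (by omega)]
    · rw [Function.update_self, if_pos (by omega)]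
      rfl
    · rw [Function.update_of_ne h.ne', if_neg (by omega), if_neg (by omega)]

/-! ### Repairing one line of the matrix -/

theorem scan_spec (A : ℕ → ℝ) (x : ℝ) (k c : ℕ) (sum : ℝ) (h : sum ≤ x) :
    k ≤ (scan A x k c sum).val.1 ∧ (scan A x k c sum).val.1 ≤ k + c ∧
      (scan A x k c sum).val.2 =
        sum + ∑ j ∈ Finset.Ico k (scan A x k c sum).val.1, A j ∧
      (scan A x k c sum).val.2 ≤ x ∧
      ((scan A x k c sum).val.1 < k + c →
        x ≤ (scan A x k c sum).val.2 + A (scan A x k c sum).val.1) := by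
  induction c generalizing k sum with
  | zero => simpa [scan, tick] using h
  | succ c ih =>
    by_cases ht : sum + A k < x
    · have e : (scan A x k (c + 1) sum).val = (scan A x (k + 1) c (sum + A k)).val := by
        simp [scan, tick, read, add, lt, ht]
      obtain ⟨h₁, h₂, h₃, h₄, h₅⟩ := ih (k + 1) (sum + A k) ht.le
      rw [e]
      refine ⟨by omega, by omega, ?_, h₄, fun h₆ => h₅ (by omega)⟩
      rw [h₃, Finset.sum_eq_sum_Ico_succ_bot (by omega : k < _)]
      ring
    · have e : (scan A x k (c + 1) sum).val = (k, sum) := by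
        simp [scan, tick, read, add, lt, ht]
      rw [e]
      simpa using ⟨h, not_lt.1 ht⟩

/-- The matrix after the repair of column `i`: the cell `(i, i)` becomes `zd`, the cell
`(i, i - 1)` becomes `zr`, and the cells of column `i` in the rows `r, …, N - 1` are moved to
column `i - 1`. -/
def moved (N i r : ℕ) (zd zr : ℝ) (M : ℕ × ℕ → ℝ) : ℕ × ℕ → ℝ := fun c =>
  if c.1 = i ∧ c.2 = i then zd
  else if c.1 = i ∧ c.2 = i - 1 then zr
  else if r ≤ c.1 ∧ c.1 < N ∧ c.2 = i - 1 then M (c.1, i)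
  else if r ≤ c.1 ∧ c.1 < N ∧ c.2 = i then 0
  else M c

theorem line_total (N : ℕ) (e : ℕ × ℕ ≃ ℕ × ℕ) (i : ℕ) (M : ℕ × ℕ → ℝ) (hiN : i ≤ N) :
    (forUp (fun k s => do
      let a ← read M (e (k, i))
      add s a) i (N - i) (0 : ℝ)).val = ∑ k ∈ Finset.Ico i N, M (e (k, i)) := by
  have := forUp_inv (σ := ℝ) (fun c s => s = ∑ k ∈ Finset.Ico i c, M (e (k, i)))
    (fun k s => do
      let a ← read M (e (k, i))
      add s a) i (N - i) 0 (by
        rintro k s h₁ - rfl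
        simp [read, add, Finset.sum_Ico_succ_top h₁]) (by simp)
  rwa [Nat.add_sub_cancel' hiN] at this

/-- The result of a repair, for columns (`e` the identity) and for rows (`e` the exchange of the
coordinates) at the same time. -/
theorem repair_spec (N : ℕ) (e : ℕ × ℕ ≃ ℕ × ℕ) (i : ℕ) (z x : ℝ) (M : ℕ × ℕ → ℝ)
    (hi : 1 ≤ i) (hiN : i < N) (hx : 0 ≤ x)
    (hlt : x < ∑ k ∈ Finset.Ico i N, M (e (k, i))) :
    ∃ (r : ℕ) (s : ℝ), i + 1 ≤ r ∧ r ≤ N ∧ s = ∑ k ∈ Finset.Ico (i + 1) r, M (e (k, i)) ∧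
      s ≤ x ∧ (r < N → x ≤ s + M (e (r, i))) ∧
      (repair N (fun k l => e (k, l)) i z x M).val ∘ e =
        moved N i r (x - s) (z - (x - s)) (M ∘ e) := by
  have htot := line_total N e i M hiN.le
  obtain ⟨h₁, h₂, h₃, h₄, h₅⟩ := scan_spec (fun k => M (e (k, i))) x (i + 1) (N - (i + 1)) 0 hx
  set R := (scan (fun k => M (e (k, i))) x (i + 1) (N - (i + 1)) 0).val with hR
  rw [Nat.add_sub_cancel' (by omega : i + 1 ≤ N)] at h₂ h₅
  refine ⟨R.1, R.2, h₁, h₂, by rw [h₃, zero_add], h₄, h₅, ?_⟩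
  have hval : (repair N (fun k l => e (k, l)) i z x M).val =
      (forUp (fun k M' => do
        let a ← read M' (e (k, i))
        let M'' ← write M' (e (k, i - 1)) a
        write M'' (e (k, i)) 0) R.1 (N - R.1)
        (Function.update (Function.update M (e (i, i)) (x - R.2)) (e (i, i - 1))
          (z - (x - R.2)))).val := by
    simp only [repair, bind_val, htot]
    simp [lt, hlt, sub, write, ← hR]
  rw [hval]
  have hupd : ∀ (A : ℕ × ℕ → ℝ) (a : ℕ × ℕ) (v : ℝ) (c : ℕ × ℕ),
      Function.update A (e a) v (e c) = if c = a then v else A (e c) := by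
    intro A a v c
    simp [Function.update_apply]
  have := forUp_inv (σ := ℕ × ℕ → ℝ)
    (fun c A => A ∘ e = moved c i R.1 (x - R.2) (z - (x - R.2)) (M ∘ e))
    (fun k M' => do
        let a ← read M' (e (k, i))
        let M'' ← write M' (e (k, i - 1)) a
        write M'' (e (k, i)) 0) R.1 (N - R.1)
      (Function.update (Function.update M (e (i, i)) (x - R.2)) (e (i, i - 1))
          (z - (x - R.2))) ?_ ?_
  · rwa [Nat.add_sub_cancel' h₂] at this
  · intro k A hk _ hA
    have hA' : ∀ c, A (e c) = moved k i R.1 (x - R.2) (z - (x - R.2)) (M ∘ e) c :=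
      fun c => congrFun hA c
    funext ⟨a, b⟩
    simp only [bind_val, read, write, Function.comp, hupd, hA', Prod.mk.injEq]
    simp only [moved, Function.comp]
    by_cases hak : a = k
    · subst hak
      by_cases hb : b = i
      · subst hb
        simp [show ¬ a = b by omega, hk, show ¬ b = b - 1 by omega]
      · by_cases hb' : b = i - 1
        · subst hb'
          simp [show ¬ a = i by omega, hk, show ¬ i - 1 = i by omega, show ¬ i = i - 1 by omega]
        · simp [hb, hb']
    · have : a < k + 1 ↔ a < k := by omega
      simp only [this, hak, false_and, if_false]
  · funext ⟨a, b⟩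
    simp only [Function.comp, hupd, moved, Prod.mk.injEq]
    have h₀ : ∀ P : Prop, ¬ (R.1 ≤ a ∧ a < R.1 ∧ P) := by
      rintro P ⟨u, v, -⟩
      omega
    simp only [h₀, if_false]
    split_ifs <;> first | rfl | omega

theorem repair_eq_self (N : ℕ) (e : ℕ × ℕ ≃ ℕ × ℕ) (i : ℕ) (z x : ℝ) (M : ℕ × ℕ → ℝ)
    (hiN : i ≤ N) (hlt : ∑ k ∈ Finset.Ico i N, M (e (k, i)) ≤ x) :
    (repair N (fun k l => e (k, l)) i z x M).val = M := by
  have htot := line_total N e i M hiN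
  simp only [repair, bind_val, htot]
  simp [lt, not_lt.2 hlt]

/-! ### The coupling of two distributions -/

/-- The cells `(k, l)` of an `N × N` matrix with `max k l = h`. -/
def hook (N h : ℕ) : Finset (ℕ × ℕ) :=
  (Finset.range N ×ˢ Finset.range N).filter fun c => max c.1 c.2 = h

theorem mem_hook {N h : ℕ} {c : ℕ × ℕ} :
    c ∈ hook N h ↔ c.1 < N ∧ c.2 < N ∧ max c.1 c.2 = h := by
  simp [hook, and_assoc]

/-- Sums over a finite set agree if the summands agree away from two elements and have the same
sum on these two. -/
theorem sum_eq_sum_of_pair {ι A : Type*} [DecidableEq ι] [AddCommMonoid A] {s : Finset ι}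
    {f g : ι → A} {a b : ι} (ha : a ∈ s) (hb : b ∈ s) (hab : a ≠ b)
    (h : f a + f b = g a + g b) (h' : ∀ c ∈ s, c ≠ a → c ≠ b → f c = g c) :
    ∑ c ∈ s, f c = ∑ c ∈ s, g c := by
  have hb' : b ∈ s.erase a := Finset.mem_erase.2 ⟨hab.symm, hb⟩
  rw [← Finset.add_sum_erase s f ha, ← Finset.add_sum_erase s g ha,
    ← Finset.add_sum_erase _ f hb', ← Finset.add_sum_erase _ g hb', ← add_assoc, ← add_assoc, h]
  congr 1
  refine Finset.sum_congr rfl fun c hc => ?_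
  simp only [Finset.mem_erase] at hc
  exact h' c hc.2.2 hc.2.1 hc.1

/-- The state of the matrix after the lines `N - 1, …, i` have been repaired.  Every hook `h`
still carries the mass `z h` that was placed on its diagonal cell, in at most two cells, and mass
off the diagonal comes from a repaired line and sits at or beyond line `i - 1`. -/
structure Stage (N : ℕ) (p q z : ℕ → ℝ) (i : ℕ) (M : ℕ × ℕ → ℝ) : Prop where
  nonneg : ∀ c, 0 ≤ M c
  bounded : ∀ k l, N ≤ k ∨ N ≤ l → M (k, l) = 0
  offdiag : ∀ k l, k ≠ l → (k < i ∧ l < i ∨ k + 1 < i ∨ l + 1 < i) → M (k, l) = 0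
  row : ∀ k, i ≤ k → k < N → ∑ l ∈ Finset.range N, M (k, l) = p k
  col : ∀ l, i ≤ l → l < N → ∑ k ∈ Finset.range N, M (k, l) = q l
  mass : ∀ h, h < N → ∑ c ∈ hook N h, M c = z h
  count : ∀ h, h < N → ∑ c ∈ hook N h, (if M c = 0 then 0 else 1) ≤ 2

theorem sum_hook_swap {A : Type*} [AddCommMonoid A] (N h : ℕ) (f : ℕ × ℕ → A) :
    ∑ c ∈ hook N h, f c.swap = ∑ c ∈ hook N h, f c := by
  refine Finset.sum_bij' (fun c _ => c.swap) (fun c _ => c.swap) ?_ ?_ ?_ ?_ ?_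
  all_goals simp +contextual [mem_hook, max_comm]

theorem Stage.swap {N : ℕ} {p q z : ℕ → ℝ} {i : ℕ} {M : ℕ × ℕ → ℝ} (h : Stage N p q z i M) :
    Stage N q p z i (M ∘ Prod.swap) where
  nonneg c := h.nonneg _
  bounded k l hkl := h.bounded _ _ hkl.symm
  offdiag k l hkl h' := h.offdiag _ _ (Ne.symm hkl) (by omega)
  row k := h.col k
  col l := h.row l
  mass k hk := by rw [← h.mass k hk]; exact sum_hook_swap N k M
  count k hk := by
    refine le_of_eq_of_le ?_ (h.count k hk)
    exact sum_hook_swap N k fun c => if M c = 0 then 0 else 1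

/-- A line that has not been repaired carries only its diagonal mass. -/
theorem Stage.diag {N : ℕ} {p q z : ℕ → ℝ} {i : ℕ} {M : ℕ × ℕ → ℝ} (h : Stage N p q z i M)
    {k : ℕ} (hk : k < i) (hkN : k < N) : M (k, k) = z k := by
  rw [← h.mass k hkN]
  symm
  refine Finset.sum_eq_single_of_mem (k, k) (by simp [mem_hook, hkN]) ?_
  rintro ⟨a, b⟩ hab hne
  rw [mem_hook] at hab
  refine h.offdiag _ _ ?_ ?_
  · rintro rfl
    simp at hab
    exact hne (by simp [hab.2])
  · simp only at hab
    omega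

theorem Stage.le_mass {N : ℕ} {p q z : ℕ → ℝ} {i : ℕ} {M : ℕ × ℕ → ℝ} (h : Stage N p q z i M)
    {k l : ℕ} (hk : k < N) (hl : l < N) : M (k, l) ≤ z (max k l) := by
  rw [← h.mass (max k l) (max_lt hk hl)]
  exact Finset.single_le_sum (fun c _ => h.nonneg c) (mem_hook.2 ⟨hk, hl, rfl⟩)

/-- The total mass is preserved. -/
theorem Stage.total {N : ℕ} {p q z : ℕ → ℝ} {i : ℕ} {M : ℕ × ℕ → ℝ} (h : Stage N p q z i M) :
    ∑ l ∈ Finset.range N, ∑ k ∈ Finset.range N, M (k, l) = ∑ k ∈ Finset.range N, z k := by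
  rw [Finset.sum_comm, ← Finset.sum_product']
  rw [← Finset.sum_fiberwise_of_maps_to (s := Finset.range N ×ˢ Finset.range N)
    (t := Finset.range N) (g := fun c => max c.1 c.2) (f := M)]
  · exact Finset.sum_congr rfl fun k hk => h.mass k (Finset.mem_range.1 hk)
  · rintro ⟨a, b⟩ hab
    simpa using hab

/-- The mass of a column just before it is repaired: it exceeds the desired mass if and only if
the initial segment of `q` is heavier than that of `p`. -/
theorem Stage.col_sum {N : ℕ} {p q : ℕ → ℝ} {i : ℕ} {M : ℕ × ℕ → ℝ}
    (h : Stage N p q (meet p q) (i + 1) M) (hi : i < N)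
    (hpq : ∑ k ∈ Finset.range N, p k = ∑ k ∈ Finset.range N, q k) :
    ∑ k ∈ Finset.range N, M (k, i) =
      q i + (∑ k ∈ Finset.range i, q k -
        min (∑ k ∈ Finset.range i, p k) (∑ k ∈ Finset.range i, q k)) := by
  have h₁ := h.total
  rw [sum_meet, hpq, min_self, ← Finset.sum_range_add_sum_Ico _ hi.le,
    Finset.sum_eq_sum_Ico_succ_bot hi, ← Finset.sum_range_add_sum_Ico q hi.le,
    Finset.sum_eq_sum_Ico_succ_bot hi] at h₁
  have h₂ : ∑ l ∈ Finset.Ico (i + 1) N, ∑ k ∈ Finset.range N, M (k, l) =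
      ∑ l ∈ Finset.Ico (i + 1) N, q l := by
    refine Finset.sum_congr rfl fun l hl => ?_
    rw [Finset.mem_Ico] at hl
    exact h.col l hl.1 hl.2
  have h₃ : ∑ l ∈ Finset.range i, ∑ k ∈ Finset.range N, M (k, l) =
      ∑ l ∈ Finset.range i, meet p q l := by
    refine Finset.sum_congr rfl fun l hl => ?_
    rw [Finset.mem_range] at hl
    rw [← h.diag (by omega : l < i + 1) (by omega)]
    refine Finset.sum_eq_single_of_mem l (Finset.mem_range.2 (by omega)) fun k _ hk => ?_
    exact h.offdiag _ _ hk (by omega)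
  rw [h₂, h₃, sum_meet] at h₁
  linarith

/-- The cells on and beyond the diagonal carry the whole mass of an unrepaired column. -/
theorem Stage.line_sum {N : ℕ} {p q z : ℕ → ℝ} {i : ℕ} {M : ℕ × ℕ → ℝ}
    (h : Stage N p q z (i + 1) M) (hi : i < N) :
    ∑ k ∈ Finset.Ico i N, M (k, i) = ∑ k ∈ Finset.range N, M (k, i) := by
  rw [← Finset.sum_range_add_sum_Ico (fun k => M (k, i)) hi.le, right_eq_add]
  refine Finset.sum_eq_zero fun k hk => ?_
  rw [Finset.mem_range] at hk
  exact h.offdiag _ _ hk.ne (by omega)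

theorem moved_off {N i r : ℕ} {zd zr : ℝ} {M : ℕ × ℕ → ℝ} {k l : ℕ} (h₁ : l ≠ i)
    (h₂ : l ≠ i - 1) : moved N i r zd zr M (k, l) = M (k, l) := by
  simp [moved, h₁, h₂]

theorem moved_row {N i r : ℕ} {zd zr : ℝ} {M : ℕ × ℕ → ℝ} {k l : ℕ} (h₁ : k ≠ i)
    (h₂ : k < r ∨ N ≤ k) : moved N i r zd zr M (k, l) = M (k, l) := by
  simp only [moved, h₁, false_and, if_false]
  rw [if_neg (by omega), if_neg (by omega)]

/-- Repairing column `i` turns its mass into `x` and changes neither the row sums, nor the other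
finished columns, nor the hook sums. -/
theorem Stage.moved {N : ℕ} {p q z : ℕ → ℝ} {i r : ℕ} {s x : ℝ} {M : ℕ × ℕ → ℝ}
    (h : Stage N p q z (i + 1) M) (hi : 1 ≤ i) (hiN : i < N) (hz : Antitone z)
    (hrow : ∑ l ∈ Finset.range N, M (i, l) = p i) (hx : x = q i)
    (hlt : x < ∑ k ∈ Finset.Ico i N, M (k, i))
    (hr : i + 1 ≤ r) (hrN : r ≤ N) (hs : s = ∑ k ∈ Finset.Ico (i + 1) r, M (k, i))
    (hsx : s ≤ x) (hreject : r < N → x ≤ s + M (r, i)) :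
    Stage N p q z i (moved N i r (x - s) (z i - (x - s)) M) := by
  -- the diagonal mass suffices: the first cell that was not selected is at most `z r ≤ z i`
  have hdiag : M (i, i) = z i := h.diag (Nat.lt_succ_self i) hiN
  have hxs : x - s ≤ z i := by
    rcases hrN.lt_or_eq with hr' | rfl
    · have h₁ := hreject hr'
      have h₂ := h.le_mass hr' hiN
      have h₃ := hz (show i ≤ max r i by omega)
      linarith
    · rw [Finset.sum_eq_sum_Ico_succ_bot hiN, ← hs, hdiag] at hlt
      linarith
  have hii : i ≠ i - 1 := by omega
  set M' := MinEntropyCoupling.moved N i r (x - s) (z i - (x - s)) M with hM'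
  have hleft : ∀ k, i ≤ k → M (k, i - 1) = 0 := fun k hk =>
    h.offdiag _ _ (by omega) (by omega)
  -- the cells `(k, i)` and `(k, i - 1)` of row `k`
  have h1 : M' (i, i) = x - s := by simp [hM', MinEntropyCoupling.moved]
  have h2 : M' (i, i - 1) = z i - (x - s) := by
    simp [hM', MinEntropyCoupling.moved, hii.symm]
  have h3 : ∀ k, r ≤ k → k < N → M' (k, i) = 0 := fun k h₁ h₂ => by
    simp [hM', MinEntropyCoupling.moved, hii, h₁, h₂, show k ≠ i by omega]
  have h4 : ∀ k, r ≤ k → k < N → M' (k, i - 1) = M (k, i) := fun k h₁ h₂ => by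
    simp [hM', MinEntropyCoupling.moved, h₁, h₂, show k ≠ i by omega]
  have h5 : ∀ k l, l ≠ i → l ≠ i - 1 → M' (k, l) = M (k, l) := fun k l => moved_off
  have h6 : ∀ k l, k ≠ i → (k < r ∨ N ≤ k) → M' (k, l) = M (k, l) := fun k l => moved_row
  have hpair : ∀ k, M' (k, i) + M' (k, i - 1) = M (k, i) + M (k, i - 1) := by
    intro k
    by_cases hk : k = i
    · rw [hk, h1, h2, hleft i le_rfl, hdiag]
      ring
    · by_cases hk' : r ≤ k ∧ k < N
      · rw [h3 k hk'.1 hk'.2, h4 k hk'.1 hk'.2, hleft k (by omega)]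
        ring
      · rw [h6 k i hk (by omega), h6 k (i - 1) hk (by omega)]
  have hrows : ∀ k, ∑ l ∈ Finset.range N, M' (k, l) = ∑ l ∈ Finset.range N, M (k, l) :=
    fun k => sum_eq_sum_of_pair (a := i) (b := i - 1) (Finset.mem_range.2 hiN)
      (Finset.mem_range.2 (by omega)) hii (hpair k) fun l _ => h5 k l
  have hhook : ∀ k l a, (k, l) ∈ hook N a → (k, l) ≠ (a, i) → (k, l) ≠ (a, i - 1) →
      M' (k, l) = M (k, l) := by
    intro k l a hkl n₁ n₂
    rw [mem_hook] at hkl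
    simp only [ne_eq, Prod.mk.injEq, not_and] at n₁ n₂ hkl
    by_cases hka : k = a
    · exact h5 k l (n₁ hka) (n₂ hka)
    · by_cases hai : i < a
      · exact h5 k l (by omega) (by omega)
      · exact h6 k l (by omega) (by omega)
  refine ⟨?_, ?_, ?_, ?_, ?_, ?_, ?_⟩
  · rintro ⟨a, b⟩
    simp only [hM', MinEntropyCoupling.moved]
    split_ifs
    · linarith
    · linarith
    · exact h.nonneg _
    · exact le_rfl
    · exact h.nonneg _
  · intro k l hkl
    by_cases hk : N ≤ k
    · rw [h6 k l (by omega) (by omega)]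
      exact h.bounded k l hkl
    · rw [h5 k l (by omega) (by omega)]
      exact h.bounded k l hkl
  · intro k l hkl hor
    have hz0 : M (k, l) = 0 := h.offdiag k l hkl (by omega)
    by_cases hk : k = i
    · subst hk
      rw [h5 k l (by omega) (by omega), hz0]
    · by_cases hk' : r ≤ k ∧ k < N
      · rw [h5 k l (by omega) (by omega), hz0]
      · rw [h6 k l hk (by omega), hz0]
  · intro k hk hkN
    rw [hrows k]
    rcases hk.eq_or_lt with rfl | hk
    · exact hrow
    · exact h.row k hk hkN
  · intro l hl hlN
    rcases hl.eq_or_lt with rfl | hl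
    · rw [← Finset.sum_range_add_sum_Ico _ hiN.le, Finset.sum_eq_sum_Ico_succ_bot hiN,
        ← Finset.sum_Ico_consecutive _ hr hrN, h1]
      have e1 : ∑ k ∈ Finset.range i, M' (k, i) = 0 := Finset.sum_eq_zero fun k hk => by
        rw [Finset.mem_range] at hk
        rw [h6 k i hk.ne (by omega)]
        exact h.offdiag _ _ hk.ne (by omega)
      have e2 : ∑ k ∈ Finset.Ico (i + 1) r, M' (k, i) = s := by
        rw [hs]
        refine Finset.sum_congr rfl fun k hk => ?_
        rw [Finset.mem_Ico] at hk
        exact h6 k i (by omega) (by omega)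
      have e3 : ∑ k ∈ Finset.Ico r N, M' (k, i) = 0 := Finset.sum_eq_zero fun k hk => by
        rw [Finset.mem_Ico] at hk
        exact h3 k hk.1 hk.2
      rw [e1, e2, e3, ← hx]
      ring
    · rw [← h.col l hl hlN]
      exact Finset.sum_congr rfl fun k _ => h5 k l (by omega) (by omega)
  · intro a ha
    rw [← h.mass a ha]
    by_cases hai : i ≤ a
    · exact sum_eq_sum_of_pair (a := (a, i)) (b := (a, i - 1))
        (mem_hook.2 ⟨ha, hiN, by simpa using hai⟩)
        (mem_hook.2 ⟨ha, by omega, by simp only; omega⟩) (by simp [hii]) (hpair a)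
        fun c => hhook c.1 c.2 a
    · refine Finset.sum_congr rfl fun c hc => ?_
      rw [mem_hook] at hc
      exact h6 c.1 c.2 (by omega) (by omega)
  · intro a ha
    rcases lt_trichotomy a i with hai | rfl | hai
    · refine le_of_eq_of_le (Finset.sum_congr rfl fun c hc => ?_) (h.count a ha)
      rw [mem_hook] at hc
      rw [show M' c = M c from h6 c.1 c.2 (by omega) (by omega)]
    · -- only the two parts of the split diagonal entry are left on this hook
      calc ∑ c ∈ hook N a, (if M' c = 0 then 0 else 1)
          ≤ ∑ c ∈ ({(a, a), (a, a - 1)} : Finset (ℕ × ℕ)), 1 := by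
            rw [← Finset.sum_filter_ne_zero]
            have hsub : (hook N a).filter (fun c => (if M' c = 0 then 0 else 1) ≠ 0) ⊆
                ({(a, a), (a, a - 1)} : Finset (ℕ × ℕ)) := by
              rintro ⟨k, l⟩ hc
              simp only [Finset.mem_filter, ne_eq, ite_eq_left_iff, one_ne_zero, imp_false,
                not_not] at hc
              by_contra hne
              simp only [Finset.mem_insert, Finset.mem_singleton, not_or] at hne
              refine hc.2 ?_
              rw [hhook k l a hc.1 hne.1 hne.2]
              have := mem_hook.1 hc.1
              simp only [Prod.mk.injEq, not_and] at hne this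
              exact h.offdiag _ _ (by omega) (by omega)
            refine (Finset.sum_le_sum fun c _ => ?_).trans
              (Finset.sum_le_sum_of_subset (f := fun _ => 1) hsub)
            split_ifs <;> omega
        _ ≤ 2 := by simpa using Finset.card_le_two
    · refine le_of_eq_of_le ?_ (h.count a ha)
      refine sum_eq_sum_of_pair (a := (a, i)) (b := (a, i - 1))
        (mem_hook.2 ⟨ha, hiN, by simpa using hai.le⟩)
        (mem_hook.2 ⟨ha, by omega, by simp only; omega⟩) (by simp [hii]) ?_
        fun c hc n₁ n₂ => by rw [show M' c = M c from hhook c.1 c.2 a hc n₁ n₂]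
      by_cases hk' : r ≤ a
      · rw [h3 a hk' ha, h4 a hk' ha, hleft a hai.le]
        simp
      · rw [h6 a i (by omega) (by omega), h6 a (i - 1) (by omega) (by omega)]

/-- The repair of column `i`, if the initial segment of `q` is the heavier one. -/
theorem Stage.repair_col {N : ℕ} {p q : ℕ → ℝ} {i : ℕ} {M : ℕ × ℕ → ℝ} (e : ℕ × ℕ ≃ ℕ × ℕ)
    (h : Stage N p q (meet p q) (i + 1) (M ∘ e)) (hi : i < N) (hp : Antitone p)
    (hq : Antitone q) (hq₀ : ∀ k, 0 ≤ q k)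
    (hpq : ∑ k ∈ Finset.range N, p k = ∑ k ∈ Finset.range N, q k)
    (hlt : ∑ k ∈ Finset.range i, p k < ∑ k ∈ Finset.range i, q k) :
    Stage N p q (meet p q) i
      ((repair N (fun k l => e (k, l)) i (meet p q i) (q i) M).val ∘ e) := by
  have hi₀ : 1 ≤ i := by
    rcases Nat.eq_zero_or_pos i with rfl | hi₀
    · simp at hlt
    · exact hi₀
  have hrow := h.swap
  rw [meet_comm] at hrow
  have hrow := hrow.col_sum hi hpq.symm
  rw [min_eq_right hlt.le, sub_self, add_zero] at hrow
  have hcol := h.line_sum hi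
  rw [h.col_sum hi hpq, min_eq_left hlt.le] at hcol
  have hlt' : q i < ∑ k ∈ Finset.Ico i N, (M ∘ e) (k, i) := by
    rw [hcol]
    linarith
  obtain ⟨r, s, h₁, h₂, h₃, h₄, h₅, h₆⟩ :=
    repair_spec N e i (meet p q i) (q i) M hi₀ hi (hq₀ i) hlt'
  rw [h₆]
  exact h.moved hi₀ hi (antitone_meet hp hq) hrow rfl hlt' h₁ h₂ h₃ h₄ h₅

/-- Column `i` is not touched if the initial segment of `q` is not the heavier one. -/
theorem Stage.repair_col_eq_self {N : ℕ} {p q : ℕ → ℝ} {i : ℕ} {M : ℕ × ℕ → ℝ}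
    (e : ℕ × ℕ ≃ ℕ × ℕ)
    (h : Stage N p q (meet p q) (i + 1) (M ∘ e)) (hi : i < N)
    (hpq : ∑ k ∈ Finset.range N, p k = ∑ k ∈ Finset.range N, q k)
    (hle : ∑ k ∈ Finset.range i, q k ≤ ∑ k ∈ Finset.range i, p k) (z : ℝ) :
    (repair N (fun k l => e (k, l)) i z (q i) M).val = M := by
  refine repair_eq_self N e i z (q i) M hi.le ?_
  have hcol := h.line_sum hi
  rw [h.col_sum hi hpq, min_eq_right hle, sub_self, add_zero] at hcol
  exact hcol.le

/-- One round of the coupling algorithm. -/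
theorem Stage.step {N : ℕ} {p q : ℕ → ℝ} {i : ℕ} {M : ℕ × ℕ → ℝ}
    (h : Stage N p q (meet p q) (i + 1) M) (hi : i < N) (hp : Antitone p) (hq : Antitone q)
    (hp₀ : ∀ k, 0 ≤ p k) (hq₀ : ∀ k, 0 ≤ q k)
    (hpq : ∑ k ∈ Finset.range N, p k = ∑ k ∈ Finset.range N, q k) :
    Stage N p q (meet p q) i
      (repair N (fun k l => (l, k)) i (meet p q i) (p i)
        (repair N (fun k l => (k, l)) i (meet p q i) (q i) M).val).val := by
  have hs := h.swap
  rcases lt_trichotomy (∑ k ∈ Finset.range i, p k) (∑ k ∈ Finset.range i, q k) with hlt | heq | hlt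
  · have h₁ := h.repair_col (Equiv.refl _) hi hp hq hq₀ hpq hlt
    simp only [Equiv.coe_refl, id, Function.comp_id] at h₁
    set M' := (repair N (fun k l => (k, l)) i (meet p q i) (q i) M).val
    rwa [show (repair N (fun k l => (l, k)) i (meet p q i) (p i) M').val = M' from
      repair_eq_self N (Equiv.prodComm ℕ ℕ) i _ _ M' hi.le ?_]
    rw [← h₁.row i le_rfl hi]
    refine Finset.sum_le_sum_of_subset_of_nonneg ?_ fun c _ _ => h₁.nonneg _
    rw [Finset.range_eq_Ico]
    exact Finset.Ico_subset_Ico_left (Nat.zero_le i)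
  · rw [show (repair N (fun k l => (k, l)) i (meet p q i) (q i) M).val = M from
      h.repair_col_eq_self (Equiv.refl _) hi hpq heq.ge _]
    rw [meet_comm] at hs
    rw [show (repair N (fun k l => (l, k)) i (meet p q i) (p i) M).val = M from
      hs.repair_col_eq_self (Equiv.prodComm ℕ ℕ) hi hpq.symm heq.le _]
    have hcol := h.col_sum hi hpq
    have hrow := hs.col_sum hi hpq.symm
    rw [heq, min_self, sub_self, add_zero] at hcol hrow
    refine ⟨h.nonneg, h.bounded, fun k l hkl h' => h.offdiag k l hkl (by omega), ?_, ?_,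
      h.mass, h.count⟩
    · intro k hk hkN
      rcases hk.eq_or_lt with rfl | hk
      · exact hrow
      · exact h.row k hk hkN
    · intro k hk hkN
      rcases hk.eq_or_lt with rfl | hk
      · exact hcol
      · exact h.col k hk hkN
  · rw [show (repair N (fun k l => (k, l)) i (meet p q i) (q i) M).val = M from
      h.repair_col_eq_self (Equiv.refl _) hi hpq hlt.le _]
    rw [meet_comm] at hs ⊢
    have h₁ := hs.repair_col (Equiv.prodComm ℕ ℕ) hi hq hp hp₀ hpq.symm hlt
    exact h₁.swap

theorem couplingCore_stage {N : ℕ} {p q : ℕ → ℝ} (hp : Antitone p) (hq : Antitone q)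
    (hp₀ : ∀ k, 0 ≤ p k) (hq₀ : ∀ k, 0 ≤ q k)
    (hpq : ∑ k ∈ Finset.range N, p k = ∑ k ∈ Finset.range N, q k) :
    Stage N p q (meet p q) 0 (couplingCore N p q).val := by
  have hdiag : (forUp (fun i M => do
      let zᵢ ← read (glb N p q).val i
      write M (i, i) zᵢ) 0 N fun _ => (0 : ℝ)).val =
      fun c : ℕ × ℕ => if c.1 = c.2 ∧ c.1 < N then meet p q c.1 else 0 := by
    have := forUp_inv (σ := ℕ × ℕ → ℝ)
      (fun c M => M = fun x => if x.1 = x.2 ∧ x.1 < c then meet p q x.1 else 0)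
      (fun i M => do
        let zᵢ ← read (glb N p q).val i
        write M (i, i) zᵢ) 0 N (fun _ => 0) ?_ (by simp)
    · rwa [zero_add] at this
    · rintro k s - hk rfl
      rw [zero_add] at hk
      funext ⟨a, b⟩
      simp only [bind_val, read, write, glb_val, hk, if_true, Function.update_apply, Prod.mk.injEq]
      by_cases ha : a = k
      · subst ha
        by_cases hb : b = a
        · simp [hb]
        · simp [hb, Ne.symm hb]
      · simp only [ha, false_and, if_false]
        simp only [show a < k + 1 ↔ a < k by omega]
  simp only [couplingCore, bind_val, newArray, hdiag]
  refine forDown_inv (Stage N p q (meet p q)) _ N _ ?_ ?_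
  · intro k M hk hM
    simp only [bind_val, read, glb_val, hk, if_true]
    exact hM.step hk hp hq hp₀ hq₀ hpq
  · refine ⟨?_, ?_, ?_, ?_, ?_, ?_, ?_⟩
    · intro c
      split_ifs
      · exact meet_nonneg hp₀ hq₀ _
      · exact le_rfl
    · intro k l hkl
      exact if_neg (by simp only; omega)
    · intro k l hkl _
      exact if_neg fun h => hkl h.1
    · intro k h₁ h₂
      omega
    · intro k h₁ h₂
      omega
    · intro a ha
      rw [Finset.sum_eq_single_of_mem (a, a) (by simp [mem_hook, ha])]
      · simp [ha]
      · rintro ⟨k, l⟩ hc hne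
        rw [mem_hook] at hc
        simp only [ne_eq, Prod.mk.injEq] at hc hne
        exact if_neg (by simp only; omega)
    · intro a ha
      rw [Finset.sum_eq_single_of_mem (a, a) (by simp [mem_hook, ha])]
      · split_ifs <;> omega
      · rintro ⟨k, l⟩ hc hne
        rw [mem_hook] at hc
        simp only [ne_eq, Prod.mk.injEq] at hc hne
        rw [if_pos]
        exact if_neg (by simp only; omega)

/-- The matrix has row sums `p` and column sums `q`, and its entries arise by splitting every
component of the greatest lower bound into at most two parts. -/
theorem minEntropyCoupling_stage {N : ℕ} {p q : ℕ → ℝ} (hp : Antitone p) (hq : Antitone q)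
    (hp₀ : ∀ k, 0 ≤ p k) (hq₀ : ∀ k, 0 ≤ q k)
    (hpq : ∑ k ∈ Finset.range N, p k = ∑ k ∈ Finset.range N, q k) :
    Stage N p q (meet p q) 0 (minEntropyCoupling N p q).val := by
  simp only [minEntropyCoupling, bind_val]
  split_ifs with hswap
  · have h := (couplingCore_stage hq hp hq₀ hp₀ hpq.symm).swap
    rw [meet_comm] at h
    simp only [bind_val, newArray]
    set M := (couplingCore N q p).val
    have hin : ∀ (s : ℕ) (R : ℕ × ℕ → ℝ), (forUp (fun t R' => do
        let a ← read M (t, s)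
        write R' (s, t) a) 0 N R).val =
        fun c => if c.1 = s ∧ c.2 < N then M c.swap else R c := by
      intro s R
      have := forUp_inv (σ := ℕ × ℕ → ℝ)
        (fun k R' => R' = fun c => if c.1 = s ∧ c.2 < k then M c.swap else R c)
        (fun t R' => do
          let a ← read M (t, s)
          write R' (s, t) a) 0 N R ?_ (by simp)
      · rwa [zero_add] at this
      · rintro k R' - - rfl
        funext ⟨a, b⟩
        simp only [bind_val, read, write, Function.update_apply, Prod.mk.injEq, Prod.swap_prod_mk]
        by_cases ha : a = s
        · by_cases hb : b = k
          · simp [ha, hb]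
          · simp only [ha, hb, and_false, if_false, true_and]
            simp only [show b < k + 1 ↔ b < k by omega]
        · simp [ha]
    have hout := forUp_inv (σ := ℕ × ℕ → ℝ)
      (fun k R => R = fun c => if c.1 < k ∧ c.2 < N then M c.swap else 0)
      (fun s R => forUp (fun t R' => do
        let a ← read M (t, s)
        write R' (s, t) a) 0 N R) 0 N (fun _ => 0) ?_ (by simp)
    · rw [hout, zero_add]
      convert h using 1
      funext c
      split_ifs with hc
      · rfl
      · exact (h.bounded c.1 c.2 (by omega)).symm
    · rintro k R - - rfl
      simp only [hin]
      funext ⟨a, b⟩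
      by_cases ha : a = k
      · by_cases hb : b < N
        · simp [ha, hb]
        · simp [hb]
      · simp only [ha, false_and, if_false]
        simp only [show a < k + 1 ↔ a < k by omega]
  · exact couplingCore_stage hp hq hp₀ hq₀ hpq

/-! ### The running time of the coupling of two distributions -/

theorem scan_steps_le (A : ℕ → ℝ) (x : ℝ) (k c : ℕ) (sum : ℝ) :
    (scan A x k c sum).steps ≤ 4 * c + 1 := by
  induction c generalizing k sum with
  | zero => simp [scan, tick]
  | succ c ih =>
    have := ih (k + 1) (sum + A k)
    simp only [scan, bind_steps, tick, read, add, lt]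
    split_ifs
    · omega
    · simp only [pure_steps]
      omega

theorem repair_steps_le (N : ℕ) (pos : ℕ → ℕ → ℕ × ℕ) (i : ℕ) (z x : ℝ) (M : ℕ × ℕ → ℝ) :
    (repair N pos i z x M).steps ≤ 11 * N + 9 := by
  have h₁ := forUp_steps_le (fun k s => do
    let a ← read M (pos k i)
    add s a) 2 i (N - i) (0 : ℝ) (fun k s => by simp [read, add])
  have h₂ := scan_steps_le (fun k => M (pos k i)) x (i + 1) (N - (i + 1)) 0
  have h₃ := fun (r : ℕ) (A : ℕ × ℕ → ℝ) => forUp_steps_le (fun k M' => do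
      let a ← read M' (pos k i)
      let M'' ← write M' (pos k (i - 1)) a
      write M'' (pos k i) 0) 3 r (N - r) A (fun k s => by simp [read, write])
  simp only [repair, bind_steps]
  split_ifs
  · simp only [bind_steps, tick, lt, sub, write] at h₃ ⊢
    refine (Nat.add_le_add_left (Nat.add_le_add h₁ (Nat.add_le_add_left (Nat.add_le_add h₂
      (Nat.add_le_add_left (Nat.add_le_add_left (Nat.add_le_add_left
        (Nat.add_le_add_left (h₃ _ _) _) _) _) _)) _)) _).trans ?_
    omega
  · simp only [tick, lt, pure_steps]
    omega

theorem glb_steps_le (N : ℕ) (p q : ℕ → ℝ) : (glb N p q).steps ≤ 10 * N + 2 := by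
  simp only [glb, bind_steps, pure_steps, newArray]
  refine (Nat.add_le_add_left (Nat.add_le_add_right
    (forUp_steps_le _ 8 _ _ _ fun k s => ?_) _) _).trans ?_
  · simp [read, add, lt, sub, write]
  · omega

theorem couplingCore_steps_le (N : ℕ) (p q : ℕ → ℝ) :
    (couplingCore N p q).steps ≤ 23 * (N * N) + 35 * N + 5 := by
  simp only [couplingCore, bind_steps, newArray]
  refine (Nat.add_le_add_left (Nat.add_le_add (glb_steps_le N p q) (Nat.add_le_add
    (forUp_steps_le _ 2 _ _ _ fun k s => ?_)
    (forDown_steps_le _ (22 * N + 21) _ _ fun k s => ?_))) _).trans ?_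
  · simp [read, write]
  · have h₁ := repair_steps_le N (fun k l => (k, l)) k ((glb N p q).val k) (q k) s
    have h₂ := repair_steps_le N (fun k l => (l, k)) k ((glb N p q).val k) (p k)
      (repair N (fun k l => (k, l)) k ((glb N p q).val k) (q k) s).val
    simp only [bind_steps, read] at h₁ h₂ ⊢
    omega
  · apply le_of_eq
    ring

theorem mustSwap_steps_le (p q : ℕ → ℝ) (c : ℕ) : (mustSwap p q c).steps ≤ 5 * c + 1 := by
  induction c with
  | zero => simp [mustSwap, tick]
  | succ c ih =>
    simp only [mustSwap, bind_steps, tick, read, lt]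
    split_ifs
    · simp only [pure_steps]
      omega
    · simp only [pure_steps]
      omega
    · omega

theorem minEntropyCoupling_steps_le (N : ℕ) (p q : ℕ → ℝ) :
    (minEntropyCoupling N p q).steps ≤ 27 * (N * N) + 42 * N + 8 := by
  have h₀ := mustSwap_steps_le p q N
  have h₁ := couplingCore_steps_le N q p
  have h₂ := couplingCore_steps_le N p q
  simp only [minEntropyCoupling, bind_steps]
  split_ifs
  · simp only [bind_steps, newArray]
    refine (Nat.add_le_add h₀ (Nat.add_le_add h₁ (Nat.add_le_add_left
      (forUp_steps_le _ (N * (2 + 1) + 1) _ _ _ fun k s => forUp_steps_le _ 2 _ _ _ fun l r => ?_)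
        _))).trans ?_
    · simp [read, write]
    · apply le_of_eq
      ring
  · omega

/-! ### Splitting components and partial sums -/

theorem sum_le_sum_range_card {p : ℕ → ℝ} (hp : Antitone p) (T : Finset ℕ) :
    ∑ t ∈ T, p t ≤ ∑ t ∈ Finset.range T.card, p t := by
  induction T using Finset.induction_on_max with
  | empty => simp
  | insert a s ha ih =>
    have hn : a ∉ s := fun h => lt_irrefl _ (ha a h)
    rw [Finset.sum_insert hn, Finset.card_insert_of_notMem hn, Finset.sum_range_succ, add_comm]
    refine add_le_add ih (hp ?_)
    calc s.card ≤ (Finset.range a).card :=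
          Finset.card_le_card fun x hx => Finset.mem_range.2 (ha x hx)
      _ = a := Finset.card_range a

theorem sum_range_getD (L : List ℝ) (k : ℕ) :
    ∑ i ∈ Finset.range k, L.getD i 0 = (L.take k).sum := by
  induction L generalizing k with
  | nil => simp
  | cons a L ih =>
    cases k with
    | zero => simp
    | succ k =>
      rw [Finset.sum_range_succ']
      simp only [List.getD_cons_succ, List.getD_cons_zero, ih, List.take_succ_cons, List.sum_cons]
      ring

/-- In a list sorted in non-increasing order, `c` or fewer entries sum to at most the sum of the
first `c`. -/
theorem sum_le_sum_take {L S : List ℝ} (hL : L.Pairwise (fun a b => b ≤ a))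
    (h₀ : ∀ a ∈ L, 0 ≤ a) (hS : S.Subperm L) {c : ℕ} (hc : S.length ≤ c) :
    S.sum ≤ (L.take c).sum := by
  obtain ⟨S', hp, hsub⟩ := hS
  rw [← hp.sum_eq]
  rw [← hp.length_eq] at hc
  clear hp
  induction hsub generalizing c with
  | slnil => simp
  | @cons S L a hsub ih =>
    rw [List.pairwise_cons] at hL
    refine (ih hL.2 (fun b hb => h₀ b (List.mem_cons_of_mem _ hb)) hc).trans ?_
    cases c with
    | zero => simp
    | succ c =>
      rw [List.take_succ_cons, List.sum_cons]
      have h₂ : (L.take (c + 1)).sum ≤ (L.take c).sum + a := by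
        rw [List.take_add_one, List.sum_append]
        gcongr
        rcases h : L[c]? with _ | b
        · simpa using h₀ a (by simp)
        · simpa using hL.1 b (List.mem_of_getElem? h)
      linarith
  | @cons_cons S L a hsub ih =>
    cases c with
    | zero => simp at hc
    | succ c =>
      rw [List.pairwise_cons] at hL
      simp only [List.take_succ_cons, List.sum_cons]
      gcongr
      exact ih hL.2 (fun b hb => h₀ b (List.mem_cons_of_mem _ hb)) (by simpa using hc)

/-- The cells of the first `k` hooks, at most `2 k` of which are nonzero, carry the sum of the
first `k` components of `z`. -/
theorem Stage.exists_cells {N : ℕ} {p q z : ℕ → ℝ} {i : ℕ} {M : ℕ × ℕ → ℝ}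
    (h : Stage N p q z i M) {k : ℕ} (hk : k ≤ N) :
    ∃ U ⊆ (Finset.range N ×ˢ Finset.range N).filter (fun c => M c ≠ 0),
      U.card ≤ 2 * k ∧ ∑ c ∈ U, M c = ∑ t ∈ Finset.range k, z t ∧
        (k = N → U = (Finset.range N ×ˢ Finset.range N).filter (fun c => M c ≠ 0)) := by
  have hmaps : ∀ c ∈ (Finset.range N ×ˢ Finset.range N).filter (fun c => max c.1 c.2 < k),
      max c.1 c.2 ∈ Finset.range k := fun c hc => by
    rw [Finset.mem_range]
    exact (Finset.mem_filter.1 hc).2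
  have hfib : ∀ t < k, ((Finset.range N ×ˢ Finset.range N).filter
      (fun c => max c.1 c.2 < k)).filter (fun c => max c.1 c.2 = t) = hook N t := by
    intro t ht
    ext c
    simp only [Finset.mem_filter, hook]
    constructor
    · exact fun h => ⟨h.1.1, h.2⟩
    · exact fun h => ⟨⟨h.1, h.2 ▸ ht⟩, h.2⟩
  refine ⟨((Finset.range N ×ˢ Finset.range N).filter
    (fun c => max c.1 c.2 < k)).filter (fun c => M c ≠ 0), ?_, ?_, ?_, ?_⟩
  · exact Finset.filter_subset_filter _ (Finset.filter_subset _ _)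
  · rw [Finset.card_filter, ← Finset.sum_fiberwise_of_maps_to hmaps]
    calc _ ≤ ∑ t ∈ Finset.range k, 2 := Finset.sum_le_sum fun t ht => by
            rw [Finset.mem_range] at ht
            rw [hfib t ht]
            refine le_of_eq_of_le (Finset.sum_congr rfl fun c _ => ?_) (h.count t (by omega))
            simp only [ne_eq, ite_not]
      _ = 2 * k := by simp [mul_comm]
  · rw [Finset.sum_filter_ne_zero, ← Finset.sum_fiberwise_of_maps_to hmaps]
    refine Finset.sum_congr rfl fun t ht => ?_
    rw [Finset.mem_range] at ht
    rw [hfib t ht, h.mass t (by omega)]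
  · rintro rfl
    congr 1
    refine Finset.filter_true_of_mem fun c hc => ?_
    simpa using hc

/-! ### Sparse arrays: sorting, loading, collecting -/

theorem insertEntry_perm (e : Entry) (L : List Entry) :
    (insertEntry e L).val.Perm (e :: L) := by
  induction L with
  | nil => exact List.Perm.refl _
  | cons f L ih =>
    simp only [insertEntry, bind_val]
    split_ifs
    · exact List.Perm.refl _
    · exact (ih.cons f).trans (List.Perm.swap e f L)

theorem insertEntry_sorted (e : Entry) {L : List Entry}
    (hL : L.Pairwise fun a b => b.1 ≤ a.1) :
    (insertEntry e L).val.Pairwise fun a b => b.1 ≤ a.1 := by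
  induction L with
  | nil => simp [insertEntry]
  | cons f L ih =>
    have hL' := List.pairwise_cons.1 hL
    simp only [insertEntry, bind_val, lt, decide_eq_true_eq]
    split_ifs with h
    · refine List.pairwise_cons.2 ⟨fun g hg => ?_, hL⟩
      rcases List.mem_cons.1 hg with rfl | hg
      · exact h.le
      · exact (hL'.1 g hg).trans h.le
    · refine List.pairwise_cons.2 ⟨fun g hg => ?_, ih hL'.2⟩
      rcases List.mem_cons.1 ((insertEntry_perm e L).mem_iff.1 hg) with rfl | hg
      · exact not_lt.1 h
      · exact hL'.1 g hg

theorem sortEntries_perm (L : List Entry) : (sortEntries L).val.Perm L := by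
  induction L with
  | nil => exact List.Perm.refl _
  | cons e L ih => exact (insertEntry_perm e _).trans (ih.cons e)

theorem sortEntries_sorted (L : List Entry) :
    (sortEntries L).val.Pairwise fun a b => b.1 ≤ a.1 := by
  induction L with
  | nil => exact List.Pairwise.nil
  | cons e L ih => exact insertEntry_sorted e ih

theorem insertEntry_steps_le (e : Entry) (L : List Entry) :
    (insertEntry e L).steps ≤ 2 * L.length + 1 := by
  induction L with
  | nil => simp [insertEntry, tick]
  | cons f L ih =>
    simp only [insertEntry, bind_steps, tick, lt, List.length_cons]
    split_ifs
    · simp only [pure_steps]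
      omega
    · simp only [bind_steps, pure_steps]
      omega

theorem sortEntries_steps_le (L : List Entry) :
    (sortEntries L).steps ≤ L.length * (2 * L.length + 2) + 1 := by
  induction L with
  | nil => simp [sortEntries, tick]
  | cons e L ih =>
    have h := insertEntry_steps_le e (sortEntries L).val
    rw [(sortEntries_perm L).length_eq] at h
    simp only [sortEntries, bind_steps, tick, List.length_cons]
    nlinarith

theorem load_val (k : ℕ) (L : List Entry) (A : ℕ → ℝ) (j : ℕ) :
    (load k L A).val j =
      if k ≤ j ∧ j < k + L.length then (L.map Prod.fst).getD (j - k) 0 else A j := by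
  induction L generalizing k A with
  | nil =>
    rw [if_neg (by simp)]
    rfl
  | cons e L ih =>
    simp only [load, bind_val, ih, write, List.length_cons]
    rcases lt_trichotomy j k with h | rfl | h
    · rw [if_neg (by omega), if_neg (by omega), Function.update_of_ne h.ne]
    · rw [if_neg (by omega), if_pos (by omega)]
      simp
    · rw [Function.update_of_ne h.ne']
      obtain ⟨i, rfl⟩ : ∃ i, j = k + 1 + i := ⟨j - (k + 1), by omega⟩
      rw [show k + 1 + i - (k + 1) = i by omega, show k + 1 + i - k = i + 1 by omega,
        List.map_cons, List.getD_cons_succ]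
      by_cases hi : i < L.length
      · rw [if_pos (by omega), if_pos (by omega)]
      · rw [if_neg (by omega), if_neg (by omega)]

theorem load_zero (L : List Entry) :
    (load 0 L fun _ => 0).val = fun j => (L.map Prod.fst).getD j 0 := by
  funext j
  rw [load_val]
  split_ifs with h
  · simp
  · rw [List.getD_eq_default]
    simpa using h

theorem load_steps (k : ℕ) (L : List Entry) (A : ℕ → ℝ) :
    (load k L A).steps = 2 * L.length + 1 := by
  induction L generalizing k A with
  | nil => rfl
  | cons e L ih =>
    simp only [load, bind_steps, tick, write, ih, List.length_cons]
    omega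

theorem sum_map_eq_sum_range {α β : Type*} [AddCommMonoid β] (L : List α) (d : α) (φ : α → β) :
    (L.map φ).sum = ∑ i ∈ Finset.range L.length, φ (L.getD i d) := by
  induction L with
  | nil => simp
  | cons a L ih =>
    rw [List.length_cons, Finset.sum_range_succ']
    simp [ih, add_comm]

theorem ite_sum_zero {ι A : Type*} [AddCommMonoid A] (P : Prop) [Decidable P] (s : Finset ι)
    (f : ι → A) : (if P then ∑ i ∈ s, f i else 0) = ∑ i ∈ s, if P then f i else 0 := by
  split_ifs <;> simp

theorem collectRow_sum {β : Type*} [AddCommMonoid β] (φ : Entry → β) (M : ℕ × ℕ → ℝ) (s : ℕ)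
    (e : Entry) (t : ℕ) (F : List Entry) :
    ((collectRow M s e t F).val.map φ).sum = ∑ j ∈ Finset.range F.length,
      if M (s, t + j) = 0 then 0 else φ (M (s, t + j), e.2 ++ (F.getD j (0, [])).2) := by
  induction F generalizing t with
  | nil => simp [collectRow]
  | cons f F ih =>
    have h := ih (t + 1)
    rw [List.length_cons, Finset.sum_range_succ']
    simp only [collectRow, bind_val, read, nonzero, append, decide_eq_true_eq, ne_eq, ite_not,
      List.getD_cons_succ, List.getD_cons_zero, add_zero]
    simp only [show ∀ j, t + 1 + j = t + (j + 1) by intro j; omega] at h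
    split_ifs with h₀
    · rw [pure_val, h, add_zero]
    · simp only [bind_val, pure_val, List.map_cons, List.sum_cons, h]
      rw [add_comm]

theorem collect_sum {β : Type*} [AddCommMonoid β] (φ : Entry → β) (M : ℕ × ℕ → ℝ)
    (F : List Entry) (s : ℕ) (E : List Entry) :
    ((collect M F s E).val.map φ).sum =
      ∑ i ∈ Finset.range E.length, ∑ j ∈ Finset.range F.length,
        if M (s + i, j) = 0 then 0
        else φ (M (s + i, j), (E.getD i (0, [])).2 ++ (F.getD j (0, [])).2) := by
  induction E generalizing s with
  | nil => simp [collect]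
  | cons e E ih =>
    have h := ih (s + 1)
    simp only [show ∀ j, s + 1 + j = s + (j + 1) by intro j; omega] at h
    rw [List.length_cons, Finset.sum_range_succ']
    simp only [collect, bind_val, append, List.map_append, List.sum_append, collectRow_sum, h,
      List.getD_cons_succ, List.getD_cons_zero, add_zero, zero_add]
    rw [add_comm]

theorem mem_collectRow {M : ℕ × ℕ → ℝ} {s t : ℕ} {e g : Entry} {F : List Entry}
    (hg : g ∈ (collectRow M s e t F).val) :
    ∃ f ∈ F, ∃ c, g = (M c, e.2 ++ f.2) := by
  induction F generalizing t with
  | nil => simp [collectRow] at hg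
  | cons f F ih =>
    simp only [collectRow, bind_val, nonzero, append] at hg
    have : g = (M (s, t), e.2 ++ f.2) ∨ g ∈ (collectRow M s e (t + 1) F).val := by
      split_ifs at hg
      · simpa [read] using hg
      · exact Or.inr hg
    rcases this with rfl | h
    · exact ⟨f, by simp, (s, t), rfl⟩
    · obtain ⟨f', hf, c, hc⟩ := ih h
      exact ⟨f', List.mem_cons_of_mem _ hf, c, hc⟩

theorem mem_collect {M : ℕ × ℕ → ℝ} {s : ℕ} {g : Entry} {E F : List Entry}
    (hg : g ∈ (collect M F s E).val) :
    ∃ e ∈ E, ∃ f ∈ F, ∃ c, g = (M c, e.2 ++ f.2) := by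
  induction E generalizing s with
  | nil => simp [collect] at hg
  | cons e E ih =>
    simp only [collect, bind_val, append, List.mem_append] at hg
    rcases hg with h | h
    · obtain ⟨f, hf, c, hc⟩ := mem_collectRow h
      exact ⟨e, by simp, f, hf, c, hc⟩
    · obtain ⟨e', he, h'⟩ := ih h
      exact ⟨e', List.mem_cons_of_mem _ he, h'⟩

theorem collectRow_length_le (M : ℕ × ℕ → ℝ) (s : ℕ) (e : Entry) (t : ℕ) (F : List Entry) :
    (collectRow M s e t F).val.length ≤ F.length := by
  induction F generalizing t with
  | nil => simp [collectRow]
  | cons f F ih =>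
    have := ih (t + 1)
    simp only [collectRow, bind_val]
    split_ifs
    · simpa using this
    · simp only [pure_val, List.length_cons]
      omega

theorem collect_length_le (M : ℕ × ℕ → ℝ) (F : List Entry) (s : ℕ) (E : List Entry) :
    (collect M F s E).val.length ≤ E.length * F.length := by
  induction E generalizing s with
  | nil => simp [collect]
  | cons e E ih =>
    have h₁ := ih (s + 1)
    have h₂ := collectRow_length_le M s e 0 F
    simp only [collect, bind_val, append, List.length_append, List.length_cons]
    rw [add_mul]
    omega

theorem collectRow_steps_le (M : ℕ × ℕ → ℝ) (s : ℕ) (e : Entry) (t : ℕ) (F : List Entry) (D : ℕ)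
    (he : e.2.length ≤ D) (hF : ∀ f ∈ F, f.2.length ≤ D) :
    (collectRow M s e t F).steps ≤ F.length * (2 * D + 4) + 1 := by
  induction F generalizing t with
  | nil => simp [collectRow, tick]
  | cons f F ih =>
    have h₁ := ih (t + 1) fun f hf => hF f (List.mem_cons_of_mem _ hf)
    have h₂ := hF f (by simp)
    simp only [collectRow, bind_steps, tick, read, nonzero, List.length_cons]
    rw [add_mul]
    split_ifs
    · simp only [bind_steps, append, pure_steps]
      omega
    · simp only [pure_steps]
      omega

theorem collect_steps_le (M : ℕ × ℕ → ℝ) (F : List Entry) (s : ℕ) (E : List Entry) (D : ℕ)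
    (hE : ∀ f ∈ E, f.2.length ≤ D) (hF : ∀ f ∈ F, f.2.length ≤ D) :
    (collect M F s E).steps ≤
      E.length * (F.length * (2 * D + 4) + F.length + E.length * F.length + 3) + 1 := by
  -- the cost of concatenating is bounded by the number of cells of the whole matrix
  suffices h : ∀ A, E.length ≤ A → (collect M F s E).steps ≤
      E.length * (F.length * (2 * D + 4) + F.length + A * F.length + 3) + 1 from h _ le_rfl
  intro A hA
  induction E generalizing s with
  | nil => simp [collect, tick]
  | cons e E ih =>
    rw [List.length_cons] at hA
    have h₁ := ih (s + 1) (fun f hf => hE f (List.mem_cons_of_mem _ hf)) (by omega)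
    have h₂ := collectRow_steps_le M s e 0 F D (hE e (by simp)) hF
    have h₃ := collectRow_length_le M s e 0 F
    have h₄ := collect_length_le M F (s + 1) E
    have h₅ : E.length * F.length ≤ A * F.length := Nat.mul_le_mul_right _ (by omega)
    simp only [collect, bind_steps, tick, append, List.length_cons]
    rw [add_mul]
    omega

/-! ### The nodes of the tree -/

/-- The list `E` is a valid label of a tree node above the leaves that carry the distributions `P`
(each a list of at most `n` components): a sorted joint distribution of the members of `P` in
sparse form.  The clause `major` is the quantitative core: with `d` leaves below the node, the
`d * k` largest components of `E` weigh at least as much as the `k` largest components of some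
member of `P`. -/
structure Node (n : ℕ) (P : List (List ℝ)) (E : List Entry) : Prop where
  nonneg : ∀ e ∈ E, 0 ≤ e.1
  sorted : E.Pairwise fun a b => b.1 ≤ a.1
  length_index : ∀ e ∈ E, e.2.length = P.length
  index_lt : ∀ e ∈ E, ∀ t ∈ e.2, t < n
  marginal : ∀ (j : ℕ) (x : List ℝ), P[j]? = some x → ∀ t,
    (E.map fun e => if e.2[j]? = some t then e.1 else 0).sum = x.getD t 0
  total : (E.map Prod.fst).sum = 1
  major : ∀ k, ∃ x ∈ P, (x.take k).sum ≤ ((E.map Prod.fst).take (P.length * k)).sum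
  length_le : E.length ≤ P.length * n

theorem antitone_getD {L : List ℝ} (hL : L.Pairwise fun a b => b ≤ a) (h₀ : ∀ a ∈ L, 0 ≤ a) :
    Antitone fun j => L.getD j 0 := by
  intro i j hij
  simp only
  by_cases hj : j < L.length
  · rw [List.getD_eq_getElem _ _ hj, List.getD_eq_getElem _ _ (by omega)]
    rcases hij.eq_or_lt with rfl | hij
    · exact le_rfl
    · exact List.pairwise_iff_getElem.1 hL i j _ _ hij
  · rw [List.getD_eq_default _ _ (by omega)]
    by_cases hi : i < L.length
    · rw [List.getD_eq_getElem _ _ hi]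
      exact h₀ _ (List.getElem_mem hi)
    · rw [List.getD_eq_default _ _ (by omega)]

theorem getD_nonneg {L : List ℝ} (h₀ : ∀ a ∈ L, 0 ≤ a) (j : ℕ) : 0 ≤ L.getD j 0 := by
  by_cases hj : j < L.length
  · rw [List.getD_eq_getElem _ _ hj]
    exact h₀ _ (List.getElem_mem hj)
  · rw [List.getD_eq_default _ _ (by omega)]

theorem Node.antitone {n : ℕ} {P : List (List ℝ)} {E : List Entry} (h : Node n P E) :
    Antitone fun j => (E.map Prod.fst).getD j 0 :=
  antitone_getD (List.pairwise_map.2 h.sorted) (by simpa using fun a b => h.nonneg (a, b))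

theorem Node.getD_nonneg {n : ℕ} {P : List (List ℝ)} {E : List Entry} (h : Node n P E) (j : ℕ) :
    0 ≤ (E.map Prod.fst).getD j 0 :=
  MinEntropyCoupling.getD_nonneg (by simpa using fun a b => h.nonneg (a, b)) j

theorem Node.sum_range {n : ℕ} {P : List (List ℝ)} {E : List Entry} (h : Node n P E) {N : ℕ}
    (hN : E.length ≤ N) : ∑ j ∈ Finset.range N, (E.map Prod.fst).getD j 0 = 1 := by
  rw [sum_range_getD, List.take_of_length_le (by simpa using hN), h.total]

theorem Stage.eq_zero {N : ℕ} {p q z : ℕ → ℝ} {M : ℕ × ℕ → ℝ} (h : Stage N p q z 0 M)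
    {c : ℕ × ℕ} (hc : p c.1 = 0 ∨ q c.2 = 0) : M c = 0 := by
  by_cases hN : c.1 < N ∧ c.2 < N
  · refine le_antisymm ?_ (h.nonneg c)
    rcases hc with hc | hc
    · rw [← hc, ← h.row c.1 (Nat.zero_le _) hN.1]
      exact Finset.single_le_sum (f := fun l => M (c.1, l)) (fun l _ => h.nonneg _)
        (Finset.mem_range.2 hN.2)
    · rw [← hc, ← h.col c.2 (Nat.zero_le _) hN.2]
      exact Finset.single_le_sum (f := fun k => M (k, c.2)) (fun l _ => h.nonneg _)
        (Finset.mem_range.2 hN.1)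
  · exact h.bounded c.1 c.2 (by omega)

/-- Two children of equal height are combined into a node. -/
theorem Node.combine {n : ℕ} {P Q : List (List ℝ)} {E F : List Entry} (hE : Node n P E)
    (hF : Node n Q F) (hPQ : P.length = Q.length) :
    Node n (P ++ Q) (combine E F).val := by
  set N := max E.length F.length with hN
  have hEN : E.length ≤ N := le_max_left _ _
  have hFN : F.length ≤ N := le_max_right _ _
  set p : ℕ → ℝ := fun j => (E.map Prod.fst).getD j 0 with hp
  set q : ℕ → ℝ := fun j => (F.map Prod.fst).getD j 0 with hq
  set M := (minEntropyCoupling N p q).val with hM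
  have hst : Stage N p q (meet p q) 0 M :=
    minEntropyCoupling_stage hE.antitone hF.antitone hE.getD_nonneg hF.getD_nonneg
      ((hE.sum_range hEN).trans (hF.sum_range hFN).symm)
  have hp0 : ∀ s, E.length ≤ s → p s = 0 := fun s hs =>
    List.getD_eq_default _ _ (by simpa using hs)
  have hq0 : ∀ s, F.length ≤ s → q s = 0 := fun s hs =>
    List.getD_eq_default _ _ (by simpa using hs)
  have hval : (MinEntropyCoupling.combine E F).val =
      (sortEntries (collect M F 0 E).val).val := by
    simp only [MinEntropyCoupling.combine, bind_val, len, newArray, load_zero]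
    rfl
  rw [hval]
  set G := (sortEntries (collect M F 0 E).val).val with hG
  have hperm : G.Perm (collect M F 0 E).val := sortEntries_perm _
  have hmem : ∀ g ∈ G, ∃ e ∈ E, ∃ f ∈ F, ∃ c, g = (M c, e.2 ++ f.2) := fun g hg =>
    mem_collect (hperm.mem_iff.1 hg)
  have hsum : ∀ {β : Type} [AddCommMonoid β] (φ : Entry → β), (G.map φ).sum =
      ∑ s ∈ Finset.range N, ∑ t ∈ Finset.range N, if M (s, t) = 0 then 0
        else φ (M (s, t), (E.getD s (0, [])).2 ++ (F.getD t (0, [])).2) := by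
    intro β _ φ
    rw [(hperm.map φ).sum_eq, collect_sum]
    simp only [zero_add]
    refine (Finset.sum_congr rfl fun s _ => ?_).trans
      (Finset.sum_subset (Finset.range_mono hEN) fun s _ hs => ?_)
    · refine Finset.sum_subset (Finset.range_mono hFN) fun t _ ht => ?_
      exact if_pos (hst.eq_zero (Or.inr (hq0 t (by simpa using ht))))
    · refine Finset.sum_eq_zero fun t _ => ?_
      exact if_pos (hst.eq_zero (Or.inl (hp0 s (by simpa using hs))))
  have hlt : ∀ s t, M (s, t) ≠ 0 → s < E.length ∧ t < F.length := fun s t h => by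
    refine ⟨lt_of_not_ge fun hs => h ?_, lt_of_not_ge fun ht => h ?_⟩
    · exact hst.eq_zero (Or.inl (hp0 s hs))
    · exact hst.eq_zero (Or.inr (hq0 t ht))
  have hlenE : ∀ s, s < E.length → (E.getD s (0, [])).2.length = P.length := fun s hs => by
    rw [List.getD_eq_getElem _ _ hs]
    exact hE.length_index _ (List.getElem_mem hs)
  -- the values of the new components are the nonzero cells of the matrix
  have hcells : (↑(G.map Prod.fst) : Multiset ℝ) =
      ((Finset.range N ×ˢ Finset.range N).filter (fun c => M c ≠ 0)).val.map M := by
    have h₁ := hsum fun e => ({e.1} : Multiset ℝ)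
    rw [show (G.map fun e => ({e.1} : Multiset ℝ)).sum = ↑(G.map Prod.fst) by
      rw [← Multiset.sum_coe, ← Multiset.map_coe, ← Multiset.map_coe]
      exact (congrArg _ (Multiset.map_map _ _ _).symm).trans (Multiset.sum_map_singleton _)] at h₁
    rw [h₁, ← Finset.sum_product', ← Multiset.sum_map_singleton (Multiset.map M _),
      Multiset.map_map]
    change _ = ∑ c ∈ (Finset.range N ×ˢ Finset.range N).filter (fun c => M c ≠ 0), {M c}
    rw [Finset.sum_filter]
    refine Finset.sum_congr rfl fun c _ => ?_
    simp only [ne_eq, ite_not, Prod.mk.eta]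
  have hsorted : (G.map Prod.fst).Pairwise fun a b => b ≤ a :=
    List.pairwise_map.2 (sortEntries_sorted _)
  have hnonneg : ∀ e ∈ G, 0 ≤ e.1 := fun e he => by
    obtain ⟨-, -, -, -, c, rfl⟩ := hmem e he
    exact hst.nonneg c
  refine ⟨hnonneg, sortEntries_sorted _, ?_, ?_, ?_, ?_, ?_, ?_⟩
  · intro g hg
    obtain ⟨e, he, f, hf, c, rfl⟩ := hmem g hg
    simp [hE.length_index e he, hF.length_index f hf]
  · intro g hg t ht
    obtain ⟨e, he, f, hf, c, rfl⟩ := hmem g hg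
    rcases List.mem_append.1 ht with ht | ht
    · exact hE.index_lt e he t ht
    · exact hF.index_lt f hf t ht
  · intro j x hx t
    rw [hsum]
    by_cases hj : j < P.length
    · rw [List.getElem?_append_left hj] at hx
      rw [← hE.marginal j x hx t, sum_map_eq_sum_range E (0, [])]
      refine Eq.trans ?_ (Finset.sum_subset (Finset.range_mono hEN) fun s _ hs => ?_).symm
      · refine Finset.sum_congr rfl fun s hs => ?_
        have hrow := hst.row s (Nat.zero_le s) (Finset.mem_range.1 hs)
        have hps : p s = (E.getD s (0, [])).1 := List.getD_map E ((0, []) : Entry) Prod.fst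
        rw [← hps, ← hrow, ite_sum_zero]
        refine Finset.sum_congr rfl fun u hu => ?_
        by_cases hz : M (s, u) = 0
        · simp [hz]
        · rw [if_neg hz, List.getElem?_append_left (by rwa [hlenE s (hlt s u hz).1])]
      · rw [List.getD_eq_default _ _ (by simpa using hs)]
        simp
    · rw [List.getElem?_append_right (by omega)] at hx
      rw [← hF.marginal _ x hx t, sum_map_eq_sum_range F (0, []), Finset.sum_comm]
      refine Eq.trans ?_ (Finset.sum_subset (Finset.range_mono hFN) fun s _ hs => ?_).symm
      · refine Finset.sum_congr rfl fun s hs => ?_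
        have hcol := hst.col s (Nat.zero_le s) (Finset.mem_range.1 hs)
        have hps : q s = (F.getD s (0, [])).1 := List.getD_map F ((0, []) : Entry) Prod.fst
        rw [← hps, ← hcol, ite_sum_zero]
        refine Finset.sum_congr rfl fun u hu => ?_
        by_cases hz : M (u, s) = 0
        · simp [hz]
        · have hl := hlenE u (hlt u s hz).1
          rw [if_neg hz, List.getElem?_append_right (by omega), hl]
      · rw [List.getD_eq_default _ _ (by simpa using hs)]
        simp
  · rw [hsum, ← hE.sum_range hEN]
    refine Finset.sum_congr rfl fun s hs => ?_
    refine Eq.trans (Finset.sum_congr rfl fun t _ => ?_)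
      (hst.row s (Nat.zero_le s) (Finset.mem_range.1 hs))
    split_ifs with h
    · exact h.symm
    · rfl
  · intro k
    obtain ⟨U, hU, hcard, hUsum, -⟩ := hst.exists_cells (min_le_right (P.length * k) N)
    have hG₁ : ∑ c ∈ U, M c ≤ ((G.map Prod.fst).take ((P ++ Q).length * k)).sum := by
      have hle : (↑(U.toList.map M) : Multiset ℝ) ≤ ↑(G.map Prod.fst) := by
        rw [hcells, ← Multiset.map_coe, Finset.coe_toList]
        exact Multiset.map_le_map (Finset.val_le_iff.2 hU)
      have := sum_le_sum_take hsorted (by simpa using fun a b => hnonneg (a, b))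
        (Multiset.coe_le.1 hle) (c := (P ++ Q).length * k) (by
          simp only [List.length_map, Finset.length_toList, List.length_append, ← hPQ]
          calc U.card ≤ 2 * min (P.length * k) N := hcard
            _ ≤ 2 * (P.length * k) := Nat.mul_le_mul_left _ (min_le_left _ _)
            _ = (P.length + P.length) * k := by ring)
      rwa [Finset.sum_map_toList] at this
    have htake : ∀ L : List Entry, L.length ≤ N →
        ((L.map Prod.fst).take (min (P.length * k) N)).sum =
          ((L.map Prod.fst).take (P.length * k)).sum := fun L hL => by
      rcases le_total (P.length * k) N with h | h
      · rw [min_eq_left h]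
      · rw [min_eq_right h, List.take_of_length_le (by simpa using hL),
          List.take_of_length_le (by simpa using hL.trans h)]
    rw [sum_meet, hp, hq, sum_range_getD, sum_range_getD, htake E hEN, htake F hFN] at hUsum
    rcases le_total ((E.map Prod.fst).take (P.length * k)).sum
      ((F.map Prod.fst).take (P.length * k)).sum with hle | hle
    · rw [min_eq_left hle] at hUsum
      obtain ⟨x, hx, hxs⟩ := hE.major k
      exact ⟨x, List.mem_append_left _ hx, hxs.trans (hUsum ▸ hG₁)⟩
    · rw [min_eq_right hle, hPQ] at hUsum
      obtain ⟨x, hx, hxs⟩ := hF.major k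
      exact ⟨x, List.mem_append_right _ hx, hxs.trans (hUsum ▸ hG₁)⟩
  · obtain ⟨U, -, hcard, -, hU⟩ := hst.exists_cells le_rfl
    have h₁ : G.length = U.card := by
      have := congrArg Multiset.card hcells
      rw [← hU rfl] at this
      simpa using this
    rw [h₁, List.length_append, ← hPQ]
    calc U.card ≤ 2 * N := hcard
      _ ≤ 2 * (P.length * n) := Nat.mul_le_mul_left _
          (max_le hE.length_le (hPQ ▸ hF.length_le))
      _ = (P.length + P.length) * n := by ring

/-- A bound for the cost of an inner node whose children have at most `W` components, with index
vectors of length at most `W`. -/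
def combineCost (W : ℕ) : ℕ :=
  27 * (W * W) + 50 * W + 16 + W * (W * (2 * W + 4) + W + W * W + 3) + W * W * (2 * (W * W) + 2)

theorem combine_steps_le {E F : List Entry} {W : ℕ} (hE : E.length ≤ W) (hF : F.length ≤ W)
    (hE' : ∀ e ∈ E, e.2.length ≤ W) (hF' : ∀ f ∈ F, f.2.length ≤ W) :
    (combine E F).steps ≤ combineCost W := by
  have hN : max E.length F.length ≤ W := max_le hE hF
  simp only [combine, bind_steps, len, newArray, load_steps]
  set N := max E.length F.length
  set M := (minEntropyCoupling N (load 0 E fun _ => 0).val (load 0 F fun _ => 0).val)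
  have h₁ : M.steps ≤ 27 * (W * W) + 42 * W + 8 := by
    refine (minEntropyCoupling_steps_le N _ _).trans ?_
    gcongr
  have h₂ : (collect M.val F 0 E).steps ≤ W * (W * (2 * W + 4) + W + W * W + 3) + 1 := by
    refine (collect_steps_le M.val F 0 E W hE' hF').trans ?_
    gcongr
  have h₃ : (sortEntries (collect M.val F 0 E).val).steps ≤ W * W * (2 * (W * W) + 2) + 1 := by
    have h := (collect_length_le M.val F 0 E).trans (Nat.mul_le_mul hE hF)
    refine (sortEntries_steps_le _).trans ?_
    gcongr
  simp only [combineCost]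
  omega

/-! ### The levels of the tree -/

/-- The list `nodes` labels the nodes at height `i` of the complete binary tree whose leaves carry
the distributions `Q`. -/
def Level (n : ℕ) (Q : List (List ℝ)) (i : ℕ) (nodes : List (List Entry)) : Prop :=
  ∃ Ps : List (List (List ℝ)), Ps.flatten = Q ∧ (∀ P ∈ Ps, P.length = 2 ^ i) ∧
    List.Forall₂ (Node n) Ps nodes

theorem Level.combinePairs {n : ℕ} {Q : List (List ℝ)} {i c : ℕ} {nodes : List (List Entry)}
    (h : Level n Q i nodes) (hc : nodes.length = 2 * c) :
    Level n Q (i + 1) (combinePairs nodes).val ∧ (combinePairs nodes).val.length = c := by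
  induction c generalizing Q nodes with
  | zero =>
    rw [Nat.mul_zero, List.length_eq_zero_iff] at hc
    subst hc
    obtain ⟨Ps, hPs, -, hF⟩ := h
    obtain rfl := List.forall₂_nil_right_iff.1 hF
    exact ⟨⟨[], hPs, by simp, List.Forall₂.nil⟩, rfl⟩
  | succ c ih =>
    obtain ⟨Ps, hPs, hlen, hF⟩ := h
    match nodes, hc, hF with
    | [], hc, _ => simp at hc
    | [_], hc, _ =>
      simp only [List.length_cons, List.length_nil] at hc
      omega
    | E :: F :: rest, hc, .cons (a := P) hE (.cons (a := P') (l₁ := Ps') hF hrest) =>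
      simp only [List.length_cons] at hc
      have hP := hlen P (by simp)
      have hP' := hlen P' (by simp)
      obtain ⟨⟨Rs, hR, hRlen, hRF⟩, hl⟩ := ih (Q := Ps'.flatten) (nodes := rest)
        ⟨Ps', rfl, fun R hR => hlen R (by simp [hR]), hrest⟩ (by omega)
      refine ⟨⟨(P ++ P') :: Rs, ?_, ?_, .cons (hE.combine hF (hP.trans hP'.symm)) hRF⟩, ?_⟩
      · rw [← hPs]
        simp [hR]
      · intro R hRm
        rcases List.mem_cons.1 hRm with rfl | hRm
        · rw [List.length_append, hP, hP', pow_succ]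
          ring
        · exact hRlen R hRm
      · simp only [MinEntropyCoupling.combinePairs, bind_val, pure_val, List.length_cons, hl]

theorem combinePairs_steps_le {nodes : List (List Entry)} {W : ℕ}
    (h : ∀ E ∈ nodes, E.length ≤ W ∧ ∀ e ∈ E, e.2.length ≤ W) :
    (combinePairs nodes).steps ≤ nodes.length * (combineCost W + 1) + 1 := by
  induction nodes using List.twoStepInduction with
  | nil => simp [combinePairs, tick]
  | singleton => simp [combinePairs, tick]
  | cons_cons E F rest ih _ =>
    have h₁ := ih fun G hG => h G (by simp [hG])
    have h₂ := combine_steps_le (h E (by simp)).1 (h F (by simp)).1 (h E (by simp)).2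
      (h F (by simp)).2
    simp only [combinePairs, bind_steps, pure_steps, tick, List.length_cons]
    rw [add_mul, add_mul]
    omega

/-- A node at height `i` has at most `2 ^ i * n` components. -/
theorem Level.bounds {n : ℕ} {Q : List (List ℝ)} {i : ℕ} {nodes : List (List Entry)}
    (h : Level n Q i nodes) {E : List Entry} (hE : E ∈ nodes) :
    E.length ≤ 2 ^ i * n ∧ ∀ e ∈ E, e.2.length = 2 ^ i := by
  obtain ⟨Ps, -, hlen, hF⟩ := h
  obtain ⟨j, hj, rfl⟩ := List.mem_iff_getElem.1 hE
  have hj' : j < Ps.length := by rwa [hF.length_eq]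
  have hN : Node n Ps[j] nodes[j] := (List.forall₂_iff_get.1 hF).2 j hj' hj
  rw [← hlen _ (List.getElem_mem hj')]
  exact ⟨hN.length_le, hN.length_index⟩

theorem Level.loop {n κ : ℕ} {Q : List (List ℝ)} {nodes : List (List Entry)}
    (h : Level n Q 0 nodes) (hlen : nodes.length = 2 ^ κ) :
    Level n Q κ (forUp (fun _ nodes => MinEntropyCoupling.combinePairs nodes) 0 κ nodes).val ∧
      (forUp (fun _ nodes => MinEntropyCoupling.combinePairs nodes) 0 κ nodes).val.length = 1 := by
  have := forUp_inv (fun i nodes => Level n Q i nodes ∧ nodes.length = 2 ^ (κ - i))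
    (fun _ nodes => MinEntropyCoupling.combinePairs nodes) 0 κ nodes (by
      rintro k s - hk ⟨h₁, h₂⟩
      refine h₁.combinePairs (c := 2 ^ (κ - (k + 1))) ?_
      rw [h₂, ← pow_succ']
      congr 1
      omega) ⟨h, by simpa using hlen⟩
  simpa using this

theorem Level.loop_steps_le {n κ W : ℕ} {Q : List (List ℝ)} {nodes : List (List Entry)}
    (h : Level n Q 0 nodes) (hlen : nodes.length = 2 ^ κ) (hW : 2 ^ κ * n ≤ W)
    (hW' : 2 ^ κ ≤ W) :
    (forUp (fun _ nodes => MinEntropyCoupling.combinePairs nodes) 0 κ nodes).steps ≤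
      κ * (W * (combineCost W + 1) + 1 + 1) + 1 := by
  refine forUp_steps_le_of_inv (fun i nodes => Level n Q i nodes ∧ nodes.length = 2 ^ (κ - i))
    (fun _ nodes => MinEntropyCoupling.combinePairs nodes) _ 0 κ nodes ?_ ?_
    ⟨h, by simpa using hlen⟩
  · rintro k s - hk ⟨h₁, h₂⟩
    refine h₁.combinePairs (c := 2 ^ (κ - (k + 1))) ?_
    rw [h₂, ← pow_succ']
    congr 1
    omega
  · rintro k s - hk ⟨h₁, h₂⟩
    have hk' : 2 ^ k ≤ 2 ^ κ := Nat.pow_le_pow_right (by omega) (by omega)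
    have hs : s.length ≤ W := by
      rw [h₂]
      exact (Nat.pow_le_pow_right (by omega) (Nat.sub_le _ _)).trans hW'
    refine (combinePairs_steps_le (W := W) fun E hE => ?_).trans ?_
    · obtain ⟨h₃, h₄⟩ := h₁.bounds hE
      exact ⟨h₃.trans ((Nat.mul_le_mul_right n hk').trans hW),
        fun e he => (h₄ e he).trans_le (hk'.trans hW')⟩
    · gcongr

/-! ### The leaves and the height of the tree -/

theorem depth_val (m : ℕ) : (depth m).val = (Nat.clog 2 m, 2 ^ Nat.clog 2 m) := by
  have hclog : Nat.clog 2 m ≤ m :=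
    (Nat.clog_le_iff_le_pow (by omega)).2 (Nat.lt_two_pow_self).le
  have := forUp_inv (fun k s => s = (min k (Nat.clog 2 m), 2 ^ min k (Nat.clog 2 m)))
    (fun _ s => (pure (if s.2 < m then (s.1 + 1, 2 * s.2) else s) : Timed (ℕ × ℕ))) 0 m (0, 1) (by
      rintro k s - - rfl
      simp only [pure_val, ← Nat.lt_clog_iff_pow_lt (show 1 < 2 by omega)]
      by_cases hk : k < Nat.clog 2 m
      · rw [min_eq_left hk.le, min_eq_left hk, if_pos hk, pow_succ']
      · rw [min_eq_right (by omega), min_eq_right (by omega), if_neg (lt_irrefl _)]) (by simp)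
  rw [zero_add, min_eq_right hclog] at this
  exact this

theorem depth_steps_le (m : ℕ) : (depth m).steps ≤ m + 1 := by
  have := forUp_steps_le (fun _ s =>
    (pure (if s.2 < m then (s.1 + 1, 2 * s.2) else s) : Timed (ℕ × ℕ))) 0 0 m (0, 1)
    (fun _ _ => le_rfl)
  rwa [zero_add, mul_one] at this

theorem two_pow_clog_le {m : ℕ} (hm : 1 ≤ m) : 2 ^ Nat.clog 2 m ≤ 2 * m := by
  rcases hm.eq_or_lt with rfl | hm
  · simp
  · have h₁ := Nat.pow_pred_clog_lt_self (b := 2) (by omega) hm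
    have h₂ := Nat.clog_pos (b := 2) (by omega) hm
    obtain ⟨c, hc⟩ : ∃ c, Nat.clog 2 m = c + 1 := ⟨Nat.clog 2 m - 1, by omega⟩
    rw [hc] at h₁ ⊢
    rw [pow_succ]
    simp only [Nat.pred_eq_sub_one, Nat.add_sub_cancel] at h₁
    omega

theorem number_map_fst (k : ℕ) (x : List ℝ) : (number k x).val.map Prod.fst = x := by
  induction x generalizing k with
  | nil => rfl
  | cons a x ih => simp [number, ih]

theorem number_length (k : ℕ) (x : List ℝ) : (number k x).val.length = x.length := by
  rw [← List.length_map (f := Prod.fst), number_map_fst]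

theorem mem_number {k : ℕ} {x : List ℝ} {e : Entry} (he : e ∈ (number k x).val) :
    e.1 ∈ x ∧ ∃ t, t < k + x.length ∧ e.2 = [t] := by
  induction x generalizing k with
  | nil => simp [number] at he
  | cons a x ih =>
    simp only [number, bind_val, pure_val, List.mem_cons] at he
    rcases he with rfl | he
    · exact ⟨by simp, k, by simp⟩
    · obtain ⟨h₁, t, h₂, h₃⟩ := ih he
      exact ⟨List.mem_cons_of_mem _ h₁, t, by simp only [List.length_cons]; omega, h₃⟩

theorem number_sum (k : ℕ) (x : List ℝ) (t : ℕ) :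
    ((number k x).val.map fun e => if e.2[0]? = some t then e.1 else 0).sum =
      if k ≤ t then x.getD (t - k) 0 else 0 := by
  induction x generalizing k with
  | nil => simp [number]
  | cons a x ih =>
    simp only [number, bind_val, pure_val, List.map_cons, List.sum_cons, ih,
      List.getElem?_cons_zero, Option.some.injEq]
    rcases lt_trichotomy t k with h | rfl | h
    · rw [if_neg h.ne', if_neg (by omega), if_neg (by omega), add_zero]
    · simp
    · obtain ⟨i, rfl⟩ : ∃ i, t = k + 1 + i := ⟨t - (k + 1), by omega⟩
      rw [if_neg h.ne, if_pos (by omega), if_pos (by omega),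
        show k + 1 + i - (k + 1) = i by omega, show k + 1 + i - k = i + 1 by omega,
        List.getD_cons_succ, zero_add]

theorem number_steps (k : ℕ) (x : List ℝ) : (number k x).steps = x.length + 1 := by
  induction x generalizing k with
  | nil => rfl
  | cons a x ih =>
    simp only [number, bind_steps, tick, ih, pure_steps, List.length_cons]
    omega

/-- A leaf is a node with a single distribution below it. -/
theorem node_leaf {x : List ℝ} (h₀ : ∀ a ∈ x, 0 ≤ a) (h₁ : x.sum = 1) : Node x.length [x] (sortEntries (number 0 x).val).val := by
  have hperm := sortEntries_perm (number 0 x).val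
  have hfst := (hperm.map Prod.fst)
  rw [number_map_fst] at hfst
  refine ⟨?_, sortEntries_sorted _, ?_, ?_, ?_, ?_, ?_, ?_⟩
  · intro e he
    exact h₀ _ (mem_number (hperm.mem_iff.1 he)).1
  · intro e he
    obtain ⟨-, t, -, h⟩ := mem_number (hperm.mem_iff.1 he)
    simp [h]
  · intro e he t ht
    obtain ⟨-, u, hu, h⟩ := mem_number (hperm.mem_iff.1 he)
    rw [h, List.mem_singleton] at ht
    omega
  · intro j y hj t
    obtain ⟨rfl, rfl⟩ : j = 0 ∧ x = y := by
      rcases j with _ | j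
      · simpa using hj
      · simp at hj
    rw [(hperm.map _).sum_eq, number_sum]
    simp
  · rw [hfst.sum_eq, h₁]
  · intro k
    refine ⟨x, by simp, ?_⟩
    refine sum_le_sum_take (List.pairwise_map.2 (sortEntries_sorted _)) ?_ ?_ ?_
    · intro a ha
      exact h₀ a (hfst.mem_iff.1 ha)
    · exact (List.take_sublist _ _).subperm.trans hfst.symm.subperm
    · simp
  · simp [hperm.length_eq, number_length]

theorem leaves_forall {P : List (List ℝ)} {n : ℕ}
    (h : ∀ x ∈ P, x.length = n ∧ (∀ a ∈ x, 0 ≤ a) ∧ x.sum = 1) :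
    List.Forall₂ (fun x E => Node n [x] E) P (leaves P).val := by
  induction P with
  | nil => exact List.Forall₂.nil
  | cons x P ih =>
    obtain ⟨rfl, h₀, h₁⟩ := h x (by simp)
    exact List.Forall₂.cons (node_leaf h₀ h₁) (ih fun y hy => h y (by simp [hy]))

theorem leaves_steps_le {P : List (List ℝ)} {n : ℕ} (h : ∀ x ∈ P, x.length = n) :
    (leaves P).steps ≤ P.length * (n + n * (2 * n + 2) + 3) + 1 := by
  induction P with
  | nil => simp [leaves, tick]
  | cons x P ih =>
    have h₁ := ih fun y hy => h y (by simp [hy])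
    have h₂ := sortEntries_steps_le (number 0 x).val
    rw [number_length, h x (by simp)] at h₂
    have h₃ := h x (by simp)
    simp only [leaves, bind_steps, tick, number_steps, pure_steps, List.length_cons]
    rw [add_mul]
    omega

theorem forall₂_replicate {α β : Type*} {R : α → β → Prop} {a : α} {b : β} (h : R a b) (c : ℕ) :
    List.Forall₂ R (List.replicate c a) (List.replicate c b) := by
  induction c with
  | zero => exact List.Forall₂.nil
  | succ c ih => exact List.Forall₂.cons h ih

/-- The leaves of the tree, including the added copies of the first distribution. -/
theorem level_zero {P : List (List ℝ)} {E : List (List Entry)} {n : ℕ} (hP : P ≠ [])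
    (h : List.Forall₂ (fun x E => Node n [x] E) P E) (c : ℕ) :
    Level n (P ++ List.replicate c (P.headD [])) 0 (E ++ List.replicate c (E.headD [])) := by
  have h' : List.Forall₂ (fun x E => Node n [x] E) (P ++ List.replicate c (P.headD []))
      (E ++ List.replicate c (E.headD [])) := by
    cases h with
    | nil => exact absurd rfl hP
    | cons h₁ h₂ =>
      exact List.rel_append (R := fun x E => Node n [x] E) (List.Forall₂.cons h₁ h₂)
        (forall₂_replicate (R := fun x E => Node n [x] E) h₁ c)
  refine ⟨(P ++ List.replicate c (P.headD [])).map fun x => [x], ?_, ?_, ?_⟩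
  · rw [← List.flatMap_def, List.flatMap_singleton']
  · intro R hR
    obtain ⟨x, -, rfl⟩ := List.mem_map.1 hR
    rfl
  · exact List.forall₂_map_left_iff.2 h'

/-! ### Summing out coordinates -/

theorem accumulate_snd (v : ℝ) (ind : List ℕ) (L : List Entry) :
    (accumulate v ind L).val.map Prod.snd =
      if ind ∈ L.map Prod.snd then L.map Prod.snd else L.map Prod.snd ++ [ind] := by
  induction L with
  | nil => simp [accumulate]
  | cons f L ih =>
    simp only [accumulate, bind_val, sameIndex, decide_eq_true_eq, List.map_cons, List.mem_cons]
    by_cases h : ind = f.2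
    · simp [h, add]
    · rw [if_neg h, bind_val, pure_val, List.map_cons, ih]
      simp only [h, false_or]
      split_ifs <;> rfl

theorem accumulate_sum (v : ℝ) (ind K : List ℕ) (L : List Entry) :
    ((accumulate v ind L).val.map fun e => if e.2 = K then e.1 else 0).sum =
      (if ind = K then v else 0) + (L.map fun e => if e.2 = K then e.1 else 0).sum := by
  induction L with
  | nil => simp [accumulate]
  | cons f L ih =>
    simp only [accumulate, bind_val, sameIndex, decide_eq_true_eq, List.map_cons, List.sum_cons]
    by_cases h : ind = f.2
    · rw [if_pos h, h]
      simp only [bind_val, pure_val, add, List.map_cons, List.sum_cons]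
      split_ifs <;> ring
    · rw [if_neg h]
      simp only [bind_val, pure_val, List.map_cons, List.sum_cons, ih]
      ring

theorem accumulate_pos {v : ℝ} (hv : 0 < v) (ind : List ℕ) {L : List Entry}
    (hL : ∀ e ∈ L, 0 < e.1) : ∀ e ∈ (accumulate v ind L).val, 0 < e.1 := by
  induction L with
  | nil => simpa [accumulate] using hv
  | cons f L ih =>
    have hf := hL f (by simp)
    have h := ih fun e he => hL e (List.mem_cons_of_mem _ he)
    simp only [accumulate, bind_val]
    split_ifs
    · intro e he
      simp only [bind_val, pure_val, add, List.mem_cons] at he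
      rcases he with rfl | he
      · exact add_pos hf hv
      · exact hL e (List.mem_cons_of_mem _ he)
    · intro e he
      simp only [bind_val, pure_val, List.mem_cons] at he
      rcases he with rfl | he
      · exact hf
      · exact h e he

theorem accumulate_steps_le (v : ℝ) {ind : List ℕ} {L : List Entry} {m : ℕ} (hi : ind.length ≤ m)
    (hL : ∀ e ∈ L, e.2.length ≤ m) :
    (accumulate v ind L).steps ≤ L.length * (2 * m + 3) + 1 := by
  induction L with
  | nil => simp [accumulate, tick]
  | cons f L ih =>
    have h₁ := ih fun e he => hL e (List.mem_cons_of_mem _ he)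
    have h₂ := hL f (by simp)
    simp only [accumulate, bind_steps, tick, sameIndex, List.length_cons]
    rw [add_mul]
    split_ifs
    · simp only [bind_steps, add, pure_steps]
      omega
    · simp only [bind_steps, pure_steps]
      omega

theorem project_cons (m : ℕ) (e : Entry) (L : List Entry) :
    (project m (e :: L)).val =
      if e.1 = 0 then (project m L).val
      else (accumulate e.1 (e.2.take m) (project m L).val).val := by
  simp only [project, bind_val, nonzero, decide_eq_true_eq, ne_eq, ite_not]
  split_ifs <;> rfl

theorem project_pos (m : ℕ) {L : List Entry} (hL : ∀ e ∈ L, 0 ≤ e.1) :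
    ∀ e ∈ (project m L).val, 0 < e.1 := by
  induction L with
  | nil => simp [project]
  | cons f L ih =>
    have h := ih fun e he => hL e (List.mem_cons_of_mem _ he)
    rw [project_cons]
    split_ifs with hf
    · exact h
    · exact accumulate_pos (lt_of_le_of_ne (hL f (by simp)) (Ne.symm hf)) _ h

theorem project_nodup (m : ℕ) (L : List Entry) : ((project m L).val.map Prod.snd).Nodup := by
  induction L with
  | nil => simp [project]
  | cons f L ih =>
    rw [project_cons]
    split_ifs with hf
    · exact ih
    · rw [accumulate_snd]
      split_ifs with h
      · exact ih
      · rw [List.nodup_append]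
        refine ⟨ih, by simp, ?_⟩
        rintro a ha b hb rfl
        exact h (List.mem_singleton.1 hb ▸ ha)

theorem mem_project {m : ℕ} {L : List Entry} {K : List ℕ}
    (hK : K ∈ (project m L).val.map Prod.snd) : ∃ e ∈ L, K = e.2.take m := by
  induction L with
  | nil => simp [project] at hK
  | cons f L ih =>
    have : K = f.2.take m ∨ K ∈ (project m L).val.map Prod.snd := by
      rw [project_cons] at hK
      split_ifs at hK with hf
      · exact Or.inr hK
      · rw [accumulate_snd] at hK
        split_ifs at hK with h
        · exact Or.inr hK
        · rw [List.mem_append, List.mem_singleton] at hK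
          exact hK.symm
    rcases this with h | h
    · exact ⟨f, by simp, h⟩
    · obtain ⟨e, he, h'⟩ := ih h
      exact ⟨e, List.mem_cons_of_mem _ he, h'⟩

theorem project_sum (m : ℕ) (K : List ℕ) (L : List Entry) :
    ((project m L).val.map fun e => if e.2 = K then e.1 else 0).sum =
      (L.map fun e => if e.2.take m = K then e.1 else 0).sum := by
  induction L with
  | nil => simp [project]
  | cons f L ih =>
    rw [project_cons, List.map_cons, List.sum_cons, ← ih]
    split_ifs with hf hK
    · rw [hf, zero_add]
    · rw [zero_add]
    · rw [accumulate_sum, if_pos ‹_›]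
    · rw [accumulate_sum, if_neg ‹_›]

theorem project_length_le (m : ℕ) (L : List Entry) : (project m L).val.length ≤ L.length := by
  induction L with
  | nil => simp [project]
  | cons f L ih =>
    rw [project_cons]
    split_ifs with hf
    · exact ih.trans (Nat.le_succ _)
    · rw [← List.length_map (f := Prod.snd), accumulate_snd]
      split_ifs
      · simpa using ih.trans (Nat.le_succ _)
      · simpa using ih

theorem project_steps_le (m : ℕ) (L : List Entry) :
    (project m L).steps ≤ L.length * (m + 4 + L.length * (2 * m + 3)) + 1 := by
  suffices h : ∀ A, L.length ≤ A →
      (project m L).steps ≤ L.length * (m + 4 + A * (2 * m + 3)) + 1 from h _ le_rfl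
  intro A hA
  induction L with
  | nil => simp [project, tick]
  | cons f L ih =>
    rw [List.length_cons] at hA
    have h₁ := ih (by omega)
    have h₂ : (accumulate f.1 (f.2.take m) (project m L).val).steps ≤
        (project m L).val.length * (2 * m + 3) + 1 := by
      refine accumulate_steps_le _ (by simp) fun e he => ?_
      obtain ⟨e', -, h⟩ := mem_project (List.mem_map_of_mem (f := Prod.snd) he)
      rw [h]
      simp
    have h₃ : (project m L).val.length * (2 * m + 3) ≤ A * (2 * m + 3) :=
      Nat.mul_le_mul_right _ ((project_length_le m L).trans (by omega))
    simp only [project, bind_steps, tick, nonzero, List.length_cons]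
    rw [add_mul]
    split_ifs
    · simp only [bind_steps, prefixOf]
      omega
    · simp only [pure_steps]
      omega

/-! ### Entropy -/

/-- Summation by parts: weights with non-negative partial sums against a non-increasing
sequence. -/
theorem sum_mul_antitone_ge {d u : ℕ → ℝ} {n : ℕ} {v : ℝ}
    (hd : ∀ j ≤ n, 0 ≤ ∑ k ∈ Finset.range j, d k)
    (hu : ∀ i j, i ≤ j → j < n → u j ≤ u i) (hv : ∀ k < n, v ≤ u k) :
    (∑ k ∈ Finset.range n, d k) * v ≤ ∑ k ∈ Finset.range n, d k * u k := by
  induction n generalizing v with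
  | zero => simp
  | succ n ih =>
    have h₁ := ih (v := u n) (fun j hj => hd j (by omega)) (fun i j hi hj => hu i j hi (by omega))
      fun k hk => hu k n hk.le (Nat.lt_succ_self n)
    have h₂ := mul_le_mul_of_nonneg_left (hv n (Nat.lt_succ_self n)) (hd (n + 1) le_rfl)
    rw [Finset.sum_range_succ] at h₂
    rw [Finset.sum_range_succ, Finset.sum_range_succ (fun k => d k * u k)]
    nlinarith

theorem mul_log_ge {x w : ℝ} (hx : 0 ≤ x) (hw : 0 < w) :
    x * Real.log w + x - w ≤ x * Real.log x := by
  rcases hx.eq_or_lt with rfl | hx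
  · simpa using hw.le
  · have h := Real.log_le_sub_one_of_pos (div_pos hw hx)
    rw [Real.log_div hw.ne' hx.ne'] at h
    have h' := mul_le_mul_of_nonneg_left h hx.le
    have e : x * (w / x - 1) = w - x := by field_simp
    rw [e] at h'
    linarith

theorem sum_range_mul_eq (f : ℕ → ℝ) (c K : ℕ) :
    ∑ i ∈ Finset.range (c * K), f i =
      ∑ k ∈ Finset.range K, ∑ j ∈ Finset.range c, f (c * k + j) := by
  induction K with
  | zero => simp
  | succ K ih => rw [Nat.mul_succ, Finset.sum_range_add, ih, Finset.sum_range_succ]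

/-- If, for every `k`, the first `c * k` components of `L` weigh at least as much as the first `k`
components of the non-increasing vector `Y`, then the entropy of `L` exceeds that of `Y` by
at most `log c`: by Gibbs' inequality `L` may be compared with the vector obtained from `Y` by
splitting every component into `c` equal parts. -/
theorem sum_mul_log_ge {L Y : List ℝ} {c : ℕ} (hc : 1 ≤ c) (hL : ∀ a ∈ L, 0 ≤ a)
    (hL₁ : L.sum = 1) (hY : ∀ a ∈ Y, 0 < a) (hYs : Y.Pairwise fun a b => b ≤ a)
    (hY₁ : Y.sum = 1) (h : ∀ k, (Y.take k).sum ≤ (L.take (c * k)).sum) :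
    (Y.map fun a => a * Real.log a).sum - Real.log c ≤ (L.map fun a => a * Real.log a).sum := by
  have hc₀ : (0 : ℝ) < c := by exact_mod_cast hc
  set K := Y.length with hK
  set x : ℕ → ℝ := fun i => L.getD i 0 with hx
  set y : ℕ → ℝ := fun i => Y.getD i 0 with hy
  have hx₀ : ∀ i, 0 ≤ x i := getD_nonneg hL
  have hyK : ∀ k < K, 0 < y k := fun k hk => by
    rw [hy]
    simp only
    rw [List.getD_eq_getElem _ _ hk]
    exact hY _ (List.getElem_mem hk)
  have hya : Antitone y := antitone_getD hYs fun a ha => (hY a ha).le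
  -- `L` is exhausted by its first `c * K` components
  set A := max L.length (c * K) with hA
  have hAsum : ∑ i ∈ Finset.range A, x i = 1 := by
    rw [hx, sum_range_getD, List.take_of_length_le (le_max_left _ _), hL₁]
  have hsplit : ∀ f : ℕ → ℝ, ∑ i ∈ Finset.range (c * K), f i +
      ∑ i ∈ Finset.Ico (c * K) A, f i = ∑ i ∈ Finset.range A, f i :=
    fun f => Finset.sum_range_add_sum_Ico f (le_max_right _ _)
  have hge : 1 ≤ ∑ i ∈ Finset.range (c * K), x i := by
    have := h K
    rw [hK, List.take_length, hY₁] at this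
    rwa [hx, sum_range_getD]
  have htail₀ : ∑ i ∈ Finset.Ico (c * K) A, x i = 0 := by
    have h₁ := hsplit x
    have h₂ : 0 ≤ ∑ i ∈ Finset.Ico (c * K) A, x i := Finset.sum_nonneg fun i _ => hx₀ i
    linarith
  have htail : ∀ i ∈ Finset.Ico (c * K) A, x i = 0 :=
    (Finset.sum_eq_zero_iff_of_nonneg fun i _ => hx₀ i).1 htail₀
  have hxsum : ∑ i ∈ Finset.range (c * K), x i = 1 := by
    rw [← hAsum, ← hsplit x, htail₀, add_zero]
  have hLsum : (L.map fun a => a * Real.log a).sum =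
      ∑ i ∈ Finset.range (c * K), x i * Real.log (x i) := by
    rw [sum_map_eq_sum_range L 0, Finset.sum_subset (Finset.range_mono (le_max_left _ (c * K))),
      ← hsplit, Finset.sum_eq_zero (s := Finset.Ico _ _), add_zero]
    · intro i hi
      have := htail i hi
      simp only [hx] at this
      rw [this, zero_mul]
    · intro i _ hi
      rw [List.getD_eq_default _ _ (by simpa using hi), zero_mul]
  have hYsum : (Y.map fun a => a * Real.log a).sum =
      ∑ k ∈ Finset.range K, y k * Real.log (y k) := sum_map_eq_sum_range Y 0 _
  have hy₁ : ∑ k ∈ Finset.range K, y k = 1 := by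
    rw [hy, sum_range_getD, hK, List.take_length, hY₁]
  set X : ℕ → ℝ := fun k => ∑ j ∈ Finset.range c, x (c * k + j) with hX
  have hXsum : ∀ k, ∑ j ∈ Finset.range k, X j = ∑ i ∈ Finset.range (c * k), x i :=
    fun k => (sum_range_mul_eq x c k).symm
  have habel : ∑ k ∈ Finset.range K, y k * Real.log (y k) ≤
      ∑ k ∈ Finset.range K, X k * Real.log (y k) := by
    have h₁ := sum_mul_antitone_ge (d := fun k => X k - y k) (u := fun k => Real.log (y k)) (n := K)
      (v := Real.log (y (K - 1))) (fun j _ => by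
        rw [Finset.sum_sub_distrib, hXsum, hx, hy, sum_range_getD, sum_range_getD, sub_nonneg]
        exact h j)
      (fun i j hij hj => Real.log_le_log (hyK j hj) (hya hij))
      (fun k hk => Real.log_le_log (hyK _ (by omega)) (hya (by omega)))
    rw [Finset.sum_sub_distrib, hXsum, hxsum, hy₁, sub_self, zero_mul] at h₁
    simp only [sub_mul] at h₁
    rw [Finset.sum_sub_distrib] at h₁
    linarith
  have hgibbs : ∑ k ∈ Finset.range K, (X k * (Real.log (y k) - Real.log c) + X k - y k) ≤
      ∑ i ∈ Finset.range (c * K), x i * Real.log (x i) := by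
    rw [sum_range_mul_eq]
    refine Finset.sum_le_sum fun k hk => ?_
    have hyk := hyK k (Finset.mem_range.1 hk)
    calc X k * (Real.log (y k) - Real.log c) + X k - y k
        = ∑ j ∈ Finset.range c, (x (c * k + j) * Real.log (y k / c) + x (c * k + j) - y k / c) := by
          rw [Finset.sum_sub_distrib, Finset.sum_add_distrib, ← Finset.sum_mul, Finset.sum_const,
            Finset.card_range, nsmul_eq_mul, mul_div_cancel₀ _ hc₀.ne',
            Real.log_div hyk.ne' hc₀.ne']
      _ ≤ _ := Finset.sum_le_sum fun j _ => mul_log_ge (hx₀ _) (div_pos hyk hc₀)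
  have hexp : ∑ k ∈ Finset.range K, (X k * (Real.log (y k) - Real.log c) + X k - y k) =
      ∑ k ∈ Finset.range K, X k * Real.log (y k) - Real.log c := by
    rw [Finset.sum_sub_distrib, Finset.sum_add_distrib, hXsum, hxsum, hy₁]
    simp only [mul_sub]
    rw [Finset.sum_sub_distrib, ← Finset.sum_mul, hXsum, hxsum]
    ring
  rw [hLsum, hYsum]
  linarith

/-- Merging components does not increase the entropy. -/
theorem sum_mul_log_le_of_merge {ι : Type*} [Fintype ι] [DecidableEq ι] (T : List (ℝ × ι))
    (hT : ∀ t ∈ T, 0 ≤ t.1) {M : ι → ℝ}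
    (hM : ∀ f, M f = (T.map fun t => if t.2 = f then t.1 else 0).sum) :
    (T.map fun t => t.1 * Real.log t.1).sum ≤ ∑ f, M f * Real.log (M f) := by
  have h₁ : ∀ (S : List (ℝ × ι)) (g : ι → ℝ),
      ∑ f, (S.map fun t => if t.2 = f then t.1 else 0).sum * g f =
        (S.map fun t => t.1 * g t.2).sum := by
    intro S g
    induction S with
    | nil => simp
    | cons t S ih => simp [add_mul, Finset.sum_add_distrib, ih, ite_mul]
  have h₂ : ∑ f, M f * Real.log (M f) = (T.map fun t => t.1 * Real.log (M t.2)).sum := by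
    rw [← h₁ T fun f => Real.log (M f)]
    exact Finset.sum_congr rfl fun f _ => by rw [← hM]
  rw [h₂]
  refine List.sum_le_sum fun t ht => ?_
  rcases (hT t ht).eq_or_lt with h | h
  · rw [← h, zero_mul, zero_mul]
  · refine mul_le_mul_of_nonneg_left (Real.log_le_log h ?_) h.le
    rw [hM]
    have := List.single_le_sum (l := T.map fun s => if s.2 = t.2 then s.1 else 0) (by
      intro a ha
      obtain ⟨s, hs, rfl⟩ := List.mem_map.1 ha
      split_ifs
      · exact hT s hs
      · exact le_rfl) _ (List.mem_map_of_mem ht)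
    simpa using this

theorem entropy_eq {ι : Type*} [Fintype ι] (x : ι → ℝ) :
    entropy x = -(∑ i, x i * Real.log (x i)) / Real.log 2 := by
  simp only [entropy, Real.logb, neg_div, Finset.sum_div, mul_div_assoc]

/-! ### Joint distributions -/

theorem sum_eq_one_of_isJoint {m n : ℕ} {p : Fin m → Fin n → ℝ} {M : (Fin m → Fin n) → ℝ}
    (hM : IsJoint p M) (j : Fin m) (hj : ∑ t, p j t = 1) : ∑ f, M f = 1 := by
  rw [← hj, ← Finset.sum_fiberwise Finset.univ (fun f : Fin m → Fin n => f j)]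
  exact Finset.sum_congr rfl fun t _ => hM.2 j t

/-- Any `k` components of a joint distribution weigh at most as much as the `k` largest components
of any of its marginals. -/
theorem sum_le_sum_take_of_isJoint {m n : ℕ} {p : Fin m → Fin n → ℝ} {M : (Fin m → Fin n) → ℝ}
    (hM : IsJoint p M) (j : Fin m) (hp : p j ∈ orderedSimplex n) (S : Finset (Fin m → Fin n))
    {k : ℕ} (hS : S.card ≤ k) : ∑ f ∈ S, M f ≤ ((List.ofFn (p j)).take k).sum := by
  have hx₀ : ∀ a ∈ List.ofFn (p j), 0 ≤ a := by
    intro a ha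
    obtain ⟨t, rfl⟩ := (List.mem_ofFn' _ _).1 ha
    exact hp.1 t
  have hxs : (List.ofFn (p j)).Pairwise fun a b => b ≤ a :=
    List.pairwise_ofFn.2 fun s t hst => hp.2.2 hst.le
  set T := S.image fun f => (f j : ℕ) with hT
  have hcard : T.card ≤ k := Finset.card_image_le.trans hS
  have h₁ : ∑ f ∈ S, M f ≤ ∑ t ∈ T, (List.ofFn (p j)).getD t 0 := by
    rw [← Finset.sum_fiberwise_of_maps_to (s := S) (t := T) (g := fun f => (f j : ℕ))
      fun f hf => Finset.mem_image_of_mem _ hf]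
    refine Finset.sum_le_sum fun t ht => ?_
    obtain ⟨f, -, rfl⟩ := Finset.mem_image.1 ht
    rw [List.getD_eq_getElem _ _ (by simp), List.getElem_ofFn, ← hM.2 j]
    refine Finset.sum_le_sum_of_subset_of_nonneg ?_ fun g _ _ => hM.1 g
    intro g hg
    rw [Finset.mem_filter] at hg ⊢
    exact ⟨Finset.mem_univ g, Fin.ext hg.2⟩
  refine h₁.trans ((sum_le_sum_range_card (antitone_getD hxs hx₀) T).trans ?_)
  rw [← sum_range_getD]
  exact Finset.sum_le_sum_of_subset_of_nonneg (Finset.range_mono hcard)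
    fun t _ _ => getD_nonneg hx₀ t

/-- The positive components of a joint distribution, in non-increasing order. -/
theorem exists_sorted_values {m n : ℕ} {p : Fin m → Fin n → ℝ} {M : (Fin m → Fin n) → ℝ}
    (hM : IsJoint p M) (j₀ : Fin m) (hp : ∀ j, p j ∈ orderedSimplex n) :
    ∃ Y : List ℝ, (∀ a ∈ Y, 0 < a) ∧ (Y.Pairwise fun a b => b ≤ a) ∧ Y.sum = 1 ∧
      (Y.map fun a => a * Real.log a).sum = ∑ f, M f * Real.log (M f) ∧
      ∀ k j, (Y.take k).sum ≤ ((List.ofFn (p j)).take k).sum := by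
  classical
  let r : (Fin m → Fin n) → (Fin m → Fin n) → Prop := fun f g => M g ≤ M f
  have : Std.Total r := ⟨fun f g => le_total (M g) (M f)⟩
  have : IsTrans _ r := ⟨fun f g h h₁ h₂ => le_trans (α := ℝ) h₂ h₁⟩
  set U := Finset.univ.filter fun f => M f ≠ 0 with hU
  set fs := U.toList.insertionSort r with hfs
  have hperm : fs.Perm U.toList := List.perm_insertionSort r _
  have hmem : ∀ f, f ∈ fs → M f ≠ 0 := fun f hf => by
    simpa [hU] using hperm.mem_iff.1 hf
  have hsum : ∀ φ : (Fin m → Fin n) → ℝ, (∀ f, M f = 0 → φ f = 0) →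
      (fs.map φ).sum = ∑ f, φ f := fun φ hφ => by
    rw [(hperm.map φ).sum_eq, Finset.sum_map_toList, hU]
    refine Finset.sum_filter_of_ne fun f _ hf h => hf (hφ f h)
  refine ⟨fs.map M, ?_, ?_, ?_, ?_, ?_⟩
  · intro a ha
    obtain ⟨f, hf, rfl⟩ := List.mem_map.1 ha
    exact lt_of_le_of_ne (hM.1 f) (hmem f hf).symm
  · exact List.pairwise_map.2 (List.pairwise_insertionSort r _)
  · rw [hsum M fun f h => h]
    exact sum_eq_one_of_isJoint hM j₀ (hp j₀).2.1
  · rw [List.map_map]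
    exact hsum (fun f => M f * Real.log (M f)) fun f h => by rw [h, zero_mul]
  · intro k j
    have hnd : (fs.take k).Nodup :=
      (hperm.nodup_iff.2 U.nodup_toList).sublist (List.take_sublist _ _)
    rw [← List.map_take, ← List.sum_toFinset _ hnd]
    refine sum_le_sum_take_of_isJoint hM j (hp j) _ ?_
    exact (List.toFinset_card_le _).trans (List.length_take_le _ _)

/-- The joint distributions with given marginals form a compact set, on which the entropy is
continuous. -/
theorem exists_isMinEntropyJoint {m n : ℕ} {p : Fin m → Fin n → ℝ} (j₀ : Fin m)
    (hp : ∑ t, p j₀ t = 1) {M : (Fin m → Fin n) → ℝ} (hM : IsJoint p M) :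
    ∃ N, IsMinEntropyJoint p N := by
  have hclosed : IsClosed {N | IsJoint p N} := by
    simp only [IsJoint, Set.ofPred_and, Set.ofPred_forall]
    refine IsClosed.inter (isClosed_iInter fun f => ?_)
      (isClosed_iInter fun j => isClosed_iInter fun t => ?_)
    · exact isClosed_le continuous_const (continuous_apply f)
    · exact isClosed_eq (continuous_finsetSum _ fun f _ => continuous_apply f) continuous_const
  have hcompact : IsCompact {N | IsJoint p N} := by
    refine (isCompact_univ_pi fun _ => isCompact_Icc (a := (0 : ℝ)) (b := 1)).of_isClosed_subset
      hclosed ?_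
    intro N hN f _
    refine ⟨hN.1 f, ?_⟩
    rw [← sum_eq_one_of_isJoint hN j₀ hp]
    exact Finset.single_le_sum (fun g _ => hN.1 g) (Finset.mem_univ f)
  have hcont : Continuous fun N : (Fin m → Fin n) → ℝ => entropy N := by
    simp only [entropy_eq]
    refine Continuous.div_const (Continuous.neg (continuous_finsetSum _ fun f _ => ?_)) _
    exact Real.continuous_mul_log.comp (continuous_apply f)
  obtain ⟨N, hN, hmin⟩ := hcompact.exists_isMinOn ⟨M, hM⟩ hcont.continuousOn
  exact ⟨N, hN, fun N' hN' => hmin hN'⟩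

/-! ### The output of the algorithm -/

/-- A bound for the running time in terms of a bound `W` for the number and the length of all
lists that occur. -/
def totalCost (W : ℕ) : ℕ :=
  (W + 1) + (W + 1) + (W * (W + W * (2 * W + 2) + 3) + 1) + (W + 1) + (W + 1) +
    (W * (W * (combineCost W + 1) + 1 + 1) + 1) + (W * (W + 4 + W * (2 * W + 3)) + 1)

/-- The label `top` of the root is a node above the input distributions and `c` further copies of
the first one; the output is its projection to the original coordinates. -/
theorem exists_root {P : List (List ℝ)} {n : ℕ} (hP : P ≠ []) (hn : 1 ≤ n)
    (h : ∀ x ∈ P, x.length = n ∧ (∀ a ∈ x, 0 ≤ a) ∧ x.sum = 1) :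
    ∃ (c : ℕ) (top : List Entry), P.length + c = 2 ^ Nat.clog 2 P.length ∧
      Node n (P ++ List.replicate c (P.headD [])) top ∧
      (minEntropyJoint P).val = (project P.length top).val ∧
      (minEntropyJoint P).steps ≤ totalCost (2 * (P.length * n)) := by
  set m := P.length with hm
  have hm₁ : 1 ≤ m := List.length_pos_iff.2 hP
  have hleaves := leaves_forall h
  set E := (leaves P).val with hE
  have hElen : E.length = m := hleaves.length_eq.symm
  set κ := Nat.clog 2 m with hκ
  have hmκ : m ≤ 2 ^ κ := Nat.le_pow_clog (by omega) m
  set c := 2 ^ κ - m with hc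
  set nodes := E ++ List.replicate c (E.headD []) with hnodes
  have hlevel := level_zero hP hleaves c
  have hlen : nodes.length = 2 ^ κ := by
    rw [hnodes, List.length_append, List.length_replicate, hElen]
    omega
  obtain ⟨hroot, hroot₁⟩ := hlevel.loop hlen
  have hval : (minEntropyJoint P).val = (project m
      ((forUp (fun _ nodes => combinePairs nodes) 0 κ nodes).val.headD [])).val := by
    simp only [minEntropyJoint, bind_val, len, depth_val, copies, append]
    rfl
  have hsteps : (minEntropyJoint P).steps = (m + 1) + ((depth m).steps + ((leaves P).steps +
      ((c + 1) + ((E.length + c + 1) +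
        ((forUp (fun _ nodes => combinePairs nodes) 0 κ nodes).steps + (project m
      ((forUp (fun _ nodes => combinePairs nodes) 0 κ nodes).val.headD [])).steps))))) := by
    simp only [minEntropyJoint, bind_steps, len, depth_val, copies, append,
      List.length_replicate]
    rfl
  obtain ⟨top, htop⟩ := List.length_eq_one_iff.1 hroot₁
  have hbounds := hroot.bounds (E := top) (by rw [htop]; simp)
  have hloop := hlevel.loop_steps_le hlen (W := 2 * (m * n)) (by
    calc 2 ^ κ * n ≤ 2 * m * n := Nat.mul_le_mul_right n (two_pow_clog_le hm₁)
      _ = 2 * (m * n) := by ring) ((two_pow_clog_le hm₁).trans (by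
        rw [Nat.mul_le_mul_left_iff (by omega)]
        exact Nat.le_mul_of_pos_right m hn))
  rw [htop, List.headD_cons] at hval hsteps
  refine ⟨c, top, by omega, ?_, hval, ?_⟩
  · obtain ⟨Ps, hPs, -, hF⟩ := hroot
    rw [htop] at hF
    cases hF with
    | cons h₁ h₂ =>
      cases h₂
      rw [← hPs]
      simpa using h₁
  · set W := 2 * (m * n) with hW
    have hmW : m ≤ W := by
      have := Nat.le_mul_of_pos_right m hn
      omega
    have hnW : n ≤ W := by
      have := Nat.le_mul_of_pos_left n hm₁
      omega
    have hκW : 2 ^ κ ≤ W := by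
      have h₁ : 2 ^ κ ≤ 2 * m := two_pow_clog_le hm₁
      have := Nat.le_mul_of_pos_right m hn
      omega
    have hκ₁ : κ ≤ W := (Nat.lt_two_pow_self (n := κ)).le.trans hκW
    have htopW : top.length ≤ W := hbounds.1.trans (by
      calc 2 ^ κ * n ≤ 2 * m * n := Nat.mul_le_mul_right n (two_pow_clog_le hm₁)
        _ = W := by rw [hW]; ring)
    have h₁ := depth_steps_le m
    have h₂ : (leaves P).steps ≤ W * (W + W * (2 * W + 2) + 3) + 1 :=
      (leaves_steps_le fun x hx => (h x hx).1).trans (by gcongr)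
    have h₃ : (forUp (fun _ nodes => combinePairs nodes) 0 κ nodes).steps ≤
        W * (W * (combineCost W + 1) + 1 + 1) + 1 := hloop.trans (by gcongr)
    have h₄ : (project m top).steps ≤ W * (W + 4 + W * (2 * W + 3)) + 1 :=
      (project_steps_le m top).trans (by gcongr)
    rw [hsteps, totalCost]
    omega

/-- The array whose sparse form the algorithm returns. -/
theorem exists_output {m n : ℕ} {p : Fin m → Fin n → ℝ} (hm : 1 ≤ m)
    (hp : ∀ i, p i ∈ orderedSimplex n) :
    ∃ M : (Fin m → Fin n) → ℝ, IsSparseForm (run p).val M ∧ IsJoint p M ∧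
      (∀ N, IsJoint p N → entropy M ≤ entropy N + (⌈Real.logb 2 (m : ℝ)⌉ : ℝ)) ∧
      (run p).steps ≤ totalCost (2 * (m * n)) := by
  classical
  let j₀ : Fin m := ⟨0, hm⟩
  have hn : 1 ≤ n := by
    rcases Nat.eq_zero_or_pos n with rfl | hn
    · have := (hp j₀).2.1
      simp at this
    · exact hn
  set P : List (List ℝ) := List.ofFn fun i => List.ofFn (p i) with hP
  have hPlen : P.length = m := by simp [hP]
  have hPne : P ≠ [] := fun h => by
    rw [h] at hPlen
    simp at hPlen
    omega
  have hPmem : ∀ x ∈ P, ∃ j, x = List.ofFn (p j) := fun x hx => by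
    obtain ⟨j, rfl⟩ := (List.mem_ofFn' _ _).1 hx
    exact ⟨j, rfl⟩
  have hPx : ∀ x ∈ P, x.length = n ∧ (∀ a ∈ x, 0 ≤ a) ∧ x.sum = 1 := by
    intro x hx
    obtain ⟨j, rfl⟩ := hPmem x hx
    refine ⟨by simp, fun a ha => ?_, by rw [List.sum_ofFn, (hp j).2.1]⟩
    obtain ⟨t, rfl⟩ := (List.mem_ofFn' _ _).1 ha
    exact (hp j).1 t
  obtain ⟨c, top, hc, htop, hval, hsteps⟩ := exists_root hPne hn hPx
  rw [hPlen] at hc hval hsteps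
  have hlen : (P ++ List.replicate c (P.headD [])).length = 2 ^ Nat.clog 2 m := by
    rw [List.length_append, List.length_replicate, hPlen, hc]
  -- the truncated index vectors are indices of the output array
  obtain ⟨T, hT⟩ : ∃ T : List (ℝ × (Fin m → Fin n)),
      T.map (fun t => (t.1, List.ofFn fun i => (t.2 i : ℕ))) =
        top.map fun e => (e.1, e.2.take m) := by
    have : (top.map fun e => (e.1, e.2.take m)) ∈ Set.range (List.map
        fun t : ℝ × (Fin m → Fin n) => (t.1, List.ofFn fun i => (t.2 i : ℕ))) := by
      rw [Set.range_list_map]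
      intro x hx
      obtain ⟨e, he, rfl⟩ := List.mem_map.1 hx
      have hl : (e.2.take m).length = m := by
        rw [List.length_take, htop.length_index e he, hlen]
        omega
      refine ⟨(e.1, fun i => ⟨(e.2.take m)[i]'(by rw [hl]; exact i.2), ?_⟩), ?_⟩
      · exact htop.index_lt e he _ (List.mem_of_mem_take (List.getElem_mem _))
      · refine Prod.ext rfl (List.ext_getElem ?_ fun i h₁ h₂ => ?_)
        · simp only [List.length_ofFn, hl]
        · simp
    exact this
  have hofFn : ∀ f g : Fin m → Fin n,
      (List.ofFn fun i => (f i : ℕ)) = (List.ofFn fun i => (g i : ℕ)) ↔ f = g := fun f g => by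
    rw [List.ofFn_inj]
    constructor
    · exact fun h => funext fun i => Fin.ext (congrFun h i)
    · rintro rfl
      rfl
  have hTpos : ∀ t ∈ T, 0 ≤ t.1 := fun t ht => by
    have h := List.mem_map_of_mem (f := fun t : ℝ × (Fin m → Fin n) =>
      (t.1, List.ofFn fun i => (t.2 i : ℕ))) ht
    rw [hT] at h
    obtain ⟨e, he, h'⟩ := List.mem_map.1 h
    rw [← (Prod.ext_iff.1 h').1]
    exact htop.nonneg e he
  have hTfst : T.map Prod.fst = top.map Prod.fst := by
    have := congrArg (List.map Prod.fst) hT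
    simpa [List.map_map, Function.comp_def] using this
  set M : (Fin m → Fin n) → ℝ := fun f => (T.map fun t => if t.2 = f then t.1 else 0).sum with hM
  have hMproj : ∀ f, ((project m top).val.map fun e =>
      if e.2 = List.ofFn (fun i => (f i : ℕ)) then e.1 else 0).sum = M f := fun f => by
    rw [project_sum]
    have := congrArg (fun L => (L.map fun e : ℝ × List ℕ =>
      if e.2 = List.ofFn (fun i => (f i : ℕ)) then e.1 else 0).sum) hT
    simp only [List.map_map, Function.comp_def, hofFn] at this
    exact this.symm
  have hvalue : ∀ v f, (v, List.ofFn fun i => (f i : ℕ)) ∈ (project m top).val →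
      v = M f := fun v f hv => by
    rw [← hMproj]
    have hnd := project_nodup m top
    revert hv hnd
    generalize (project m top).val = R
    intro hv hnd
    induction R with
    | nil => simp at hv
    | cons e R ih =>
      rw [List.map_cons, List.nodup_cons] at hnd
      rw [List.map_cons, List.sum_cons]
      rcases List.mem_cons.1 hv with rfl | hv
      · rw [if_pos rfl, left_eq_add]
        refine List.sum_eq_zero fun a ha => ?_
        obtain ⟨e, he, rfl⟩ := List.mem_map.1 ha
        exact if_neg fun h => hnd.1 (List.mem_map.2 ⟨e, he, h⟩)
      · rw [if_neg, zero_add]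
        · exact ih hv hnd.2
        · exact fun h => hnd.1 (List.mem_map.2 ⟨_, hv, h.symm⟩)
  have hjoint : IsJoint p M := by
    refine ⟨fun f => List.sum_nonneg fun a ha => ?_, fun j t => ?_⟩
    · obtain ⟨t, ht, rfl⟩ := List.mem_map.1 ha
      split_ifs
      · exact hTpos t ht
      · exact le_rfl
    · have h₁ : ∀ S : List (ℝ × (Fin m → Fin n)), ∑ f ∈ Finset.univ.filter (fun f => f j = t),
          (S.map fun s => if s.2 = f then s.1 else 0).sum =
            (S.map fun s => if s.2 j = t then s.1 else 0).sum := by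
        intro S
        induction S with
        | nil => simp
        | cons s S ih => simp [Finset.sum_add_distrib, ih]
      have h₂ := htop.marginal j (List.ofFn (p j)) (by
        rw [List.getElem?_append_left (by rw [hPlen]; exact j.2)]
        simp [hP]) t
      rw [List.getD_eq_getElem _ _ (by simp), List.getElem_ofFn] at h₂
      rw [hM, h₁, ← Fin.eta t t.2, ← h₂]
      have h₃ := congrArg (fun L => (L.map fun e : ℝ × List ℕ =>
        if e.2[(j : ℕ)]? = some (t : ℕ) then e.1 else 0).sum) hT
      simp only [List.map_map, Function.comp_def, List.getElem?_take_of_lt j.2] at h₃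
      rw [← h₃]
      congr 1
      refine List.map_congr_left fun s _ => ?_
      simp [Fin.ext_iff]
  refine ⟨M, ⟨?_, ?_⟩, hjoint, ?_, hsteps⟩
  · rw [run, hval]
    exact project_nodup m top
  · intro v ind
    rw [run, hval]
    constructor
    · intro hv
      refine ⟨(project_pos m htop.nonneg _ hv).ne', ?_⟩
      obtain ⟨e, he, hind⟩ := mem_project (List.mem_map_of_mem (f := Prod.snd) hv)
      have h₁ := List.mem_map_of_mem (f := fun e : Entry => (e.1, e.2.take m)) he
      rw [← hT] at h₁
      obtain ⟨t, -, ht⟩ := List.mem_map.1 h₁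
      have h₂ : ind = List.ofFn fun i => (t.2 i : ℕ) := hind.trans (Prod.ext_iff.1 ht).2.symm
      exact ⟨t.2, h₂, hvalue v t.2 (h₂ ▸ hv)⟩
    · rintro ⟨hv, f, rfl, rfl⟩
      have h₁ : ∃ e ∈ (project m top).val, e.2 = List.ofFn fun i => (f i : ℕ) := by
        by_contra hne
        push Not at hne
        refine hv ?_
        rw [← hMproj]
        refine List.sum_eq_zero fun a ha => ?_
        obtain ⟨e, he, rfl⟩ := List.mem_map.1 ha
        exact if_neg (hne e he)
      obtain ⟨⟨w, ind⟩, he, rfl⟩ := h₁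
      rwa [← hvalue w f he]
  · intro N hN
    obtain ⟨Y, hY, hYs, hY₁, hYlog, hYk⟩ := exists_sorted_values hN j₀ hp
    have h₁ : (Y.map fun a => a * Real.log a).sum - Real.log ((2 ^ Nat.clog 2 m : ℕ) : ℝ) ≤
        ((top.map Prod.fst).map fun a => a * Real.log a).sum := by
      refine sum_mul_log_ge Nat.one_le_two_pow ?_ htop.total hY hYs hY₁ fun k => ?_
      · intro a ha
        obtain ⟨e, he, rfl⟩ := List.mem_map.1 ha
        exact htop.nonneg e he
      · obtain ⟨x, hx, hxk⟩ := htop.major k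
        rw [hlen] at hxk
        have hxP : x ∈ P := by
          rcases List.mem_append.1 hx with hx | hx
          · exact hx
          · rw [List.eq_of_mem_replicate hx, List.headD_eq_head?_getD,
              List.head?_eq_some_head hPne]
            exact List.head_mem hPne
        obtain ⟨j, rfl⟩ := hPmem x hxP
        exact (hYk k j).trans hxk
    have h₂ := sum_mul_log_le_of_merge T hTpos (M := M) fun f => rfl
    rw [← hTfst, List.map_map, hYlog] at h₁
    have h₃ := h₁.trans h₂
    have hceil : (⌈Real.logb 2 (m : ℝ)⌉ : ℝ) = Nat.clog 2 m := by
      have := Real.ceil_logb_natCast (b := 2) (r := (m : ℝ)) (Nat.cast_nonneg m)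
      rw [Int.clog_natCast] at this
      rw [Nat.cast_ofNat] at this
      rw [this, Int.cast_natCast]
    have hlog : 0 < Real.log 2 := Real.log_pos (by norm_num)
    rw [hceil, entropy_eq, entropy_eq, ← mul_div_cancel_right₀ (Nat.clog 2 m : ℝ) hlog.ne',
      ← add_div]
    refine div_le_div_of_nonneg_right ?_ hlog.le
    push_cast at h₃
    rw [Real.log_pow] at h₃
    linarith

open Polynomial in
theorem totalCost_isPolynomial : ∃ T : Polynomial ℕ, ∀ x, T.eval x = totalCost (2 * x) := by
  let W : Polynomial ℕ := 2 * X
  let C : Polynomial ℕ :=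
    27 * (W * W) + 50 * W + 16 + W * (W * (2 * W + 4) + W + W * W + 3) + W * W * (2 * (W * W) + 2)
  refine ⟨(W + 1) + (W + 1) + (W * (W + W * (2 * W + 2) + 3) + 1) + (W + 1) + (W + 1) +
    (W * (W * (C + 1) + 1 + 1) + 1) + (W * (W + 4 + W * (2 * W + 3)) + 1), fun x => ?_⟩
  simp [W, C, totalCost, combineCost]

end MinEntropyCoupling

theorem theorem5 :
    ∃ T : Polynomial ℕ, ∀ (m n : ℕ) (p : Fin m → Fin n → ℝ), 1 ≤ m →
      (∀ i, p i ∈ MinEntropyCoupling.orderedSimplex n) →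
      (∃ Mstar, MinEntropyCoupling.IsMinEntropyJoint p Mstar) ∧
      (∃ M : (Fin m → Fin n) → ℝ,
        MinEntropyCoupling.IsSparseForm (MinEntropyCoupling.run p).val M ∧
        MinEntropyCoupling.IsJoint p M ∧
        ∀ Mstar, MinEntropyCoupling.IsMinEntropyJoint p Mstar →
          MinEntropyCoupling.entropy M ≤
            MinEntropyCoupling.entropy Mstar + (⌈Real.logb 2 (m : ℝ)⌉ : ℝ)) ∧
      (MinEntropyCoupling.run p).steps ≤ T.eval (m * n) := by
  obtain ⟨T, hT⟩ := MinEntropyCoupling.totalCost_isPolynomial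
  refine ⟨T, fun m n p hm hp => ?_⟩
  obtain ⟨M, h₁, h₂, h₃, h₄⟩ := MinEntropyCoupling.exists_output hm hp
  exact ⟨MinEntropyCoupling.exists_isMinEntropyJoint ⟨0, hm⟩ (hp _).2.1 h₂,
    ⟨M, h₁, h₂, fun N hN => h₃ N hN.1⟩, (hT (m * n)).symm ▸ h₄⟩
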